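/- Let $p(z)=a_0z^n+a_1z^{n-1}+\cdots+a_n$ and $q(z)=b_0z^n+b_1z^{n-1}+\cdots+b_n$ be complex polynomials with $a_0\neq 0$ and $q\not\equiv 0$ (so $\deg q<\deg p$ means $b_0=0$ and $\deg q=\deg p$ means $b_0\ne0$; put $a_i=b_i=0$ for $i>n$). Let $$R(z)=\frac{q(z)}{p(z)}=s_{-1}+\frac{s_0}{z}+\frac{s_1}{z^2}+\cdots$$ be the expansion at infinity, and let $R$ have exactly $r$ poles, counting multiplicities. Put $D_j=\det(s_{\alpha+\beta})_{0\le\alpha,\beta<j}$ and $\widehat D_j=\det(s_{\alpha+\beta+1})_{0\le\alpha,\beta<j}$, with $D_0=\widehat D_0=1$. Put $k=2r-1$ if $R$ has a pole at $0$, and $k=2r$ otherwise. The infinite matrix $H(p,q)$ has the following rows, numbered $0,1,2,\dots$. If $b_0=0$, row $2i$ is $(a_0,a_1,\dots)$ preceded by $i$ zeros, and row $2i+1$ is $(b_1,b_2,\dots)$ preceded by $i+1$ zeros. If $b_0\neq0$, row $2i$ is $(b_0,b_1,\dots)$ preceded by $i$ zeros, and row $2i+1$ is $(a_0,a_1,\dots)$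 preceded by $i+1$ zeros. Let $\eta_j$ be the leading principal minor of order $j$ of $H(p,q)$, with $\eta_0=1$. Let $H(0,1)$ be the same matrix for the constant polynomials $0$ and $1$: its row $2i$ has a single nonzero entry, equal to $1$, in column $i$ (columns numbered from $0$), and its odd rows vanish. Let $J(c)$ be the infinite matrix with rows $(c,1,0,0,0,\dots)$, $(0,0,1,0,0,\dots)$, $(0,0,c,1,0,\dots)$, $(0,0,0,0,1,\dots),\dots$: row $2i$ has $c$ in column $2i$ and $1$ in column $2i+1$, and row $2i+1$ has $1$ in column $2i+2$. For $g(z)=g_0z^l+\cdots+g_l$ of degree $l$ let $\mathcal T(g)$ be the infinite upper triangular Toeplitz matrix with first row $(g_0,g_1,\dots,g_l,0,0,\dots)$. The following four conditions are equivalent. 1. $D_j\ne0$ for $1\le j\le r$, $\widehat D_j\neq0$ for $1\le j\le r-1$, and $D_j=\widehat D_j=0$ for all $j\ge r+1$. 2. $R$ has a Stieltjes continued fraction expansion: there are nonzero $c_1,\dots,c_k\in\mathbb C$ such that, with $c_0=b_0/a_0$, $$R(z)-c_0=\cfrac1{c_1z+\cfrac1{c_2+\cfrac1{c_3z+\cfrac1{\ddots+\cfrac1T}}}},\qquad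 T=\begin{cases}c_{2r}&\text{if } R \text{ has no pole at } 0,\\ c_{2r-1}z&\text{if } R\text{ has a pole at }0,\end{cases}$$ where the fraction has $k$ partial quotients (for $k=0$ it is $0$). 3. The Euclidean algorithm applied to $p(z^2)$ and $zq(z^2)-\frac{b_0}{a_0}zp(z^2)$ is regular (all its quotients are polynomials of degree one), and $\deg q\ge n-1$. 4. There are complex numbers $c_j$ and a greatest common divisor $g$ of $p$ and $q$ (normalized suitably) such that $$H(p,q)=J(c_1)J(c_2)\cdots J(c_k)H(0,1)\mathcal T(g)\quad\text{if }\deg q<\deg p,$$ $$H(p,q)=J(c_0)J(c_1)\cdots J(c_k)H(0,1)\mathcal T(g)\quad\text{if }\deg q=\deg p.$$ Moreover, $\widehat D_r=0$ if and only if $R$ has a pole at $0$. Finally, whenever numbers $c_j$ satisfy 2 or 4, then $c_1,\dots,c_k$ are nonzero and $$c_{2j}=-\frac{D_j^2}{\widehat D_{j-1}\widehat D_j}\quad(1\le j\le\lfloor k/2\rfloor),\qquad c_{2j-1}=\frac{\widehat D_{j-1}^2}{D_{j-1}D_j}\quad(1\le j\le r);$$ equivalently, if $\deg q<\deg p$,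 $$c_{2j-1}=\frac{\eta_{2j-1}^2}{\eta_{2j-2}\,\eta_{2j}}\quad(1\le j\le r),\qquad c_{2j}=\frac{\eta_{2j}^2}{\eta_{2j-1}\,\eta_{2j+1}}\quad(1\le j\le\lfloor k/2\rfloor),$$ and if $\deg q=\deg p$, $$c_{2j-1}=\frac{\eta_{2j}^2}{\eta_{2j-1}\,\eta_{2j+1}}\quad(1\le j\le r),\qquad c_{2j}=\frac{\eta_{2j+1}^2}{\eta_{2j}\,\eta_{2j+2}}\quad(0\le j\le\lfloor k/2\rfloor).$$ -/

import Mathlib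

open Polynomial

noncomputable section

/-- For `f = f₀ zⁿ + f₁ zⁿ⁻¹ + ⋯ + fₙ` (formal degree `n`), the coefficient `f_i`, counted
from the top, with `f_i = 0` for `i > n`. -/
def descCoeff (n : ℕ) (f : ℂ[X]) (i : ℕ) : ℂ :=
  if i ≤ n then f.coeff (n - i) else 0

/-- The rational function `q / p`. -/
def ratioFun (p q : ℂ[X]) : RatFunc ℂ :=
  algebraMap ℂ[X] (RatFunc ℂ) q / algebraMap ℂ[X] (RatFunc ℂ) p

/-- The number of (finite) poles of a rational function, counted with multiplicities: the number
of roots of the denominator of its reduced form. -/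
def poleCount (R : RatFunc ℂ) : ℕ := Multiset.card R.denom.roots

/-- `R` has a pole at the point `z`. -/
def HasPoleAt (R : RatFunc ℂ) (z : ℂ) : Prop := R.denom.IsRoot z

/-- The expansion at infinity `q(z)/p(z) = s₋₁ + s₀/z + s₁/z² + ⋯`, as a power series in `1/z`:
after division by `zⁿ` the polynomials `p` and `q` become `a₀ + a₁/z + ⋯` and
`b₀ + b₁/z + ⋯`. -/
def expansionAtInfinity (n : ℕ) (p q : ℂ[X]) : PowerSeries ℂ :=
  PowerSeries.mk (descCoeff n q) * (PowerSeries.mk (descCoeff n p))⁻¹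

/-- The coefficient `s_j` (`j ≥ 0`) of `1/z^(j+1)` in the expansion of `q/p` at infinity. -/
def laurentCoeff (n : ℕ) (p q : ℂ[X]) (j : ℕ) : ℂ :=
  PowerSeries.coeff (j + 1) (expansionAtInfinity n p q)

/-- The Hankel minor `D_j = det (s_{α+β})`, `0 ≤ α, β < j`; in particular `D_0 = 1`. -/
def hankelMinor (s : ℕ → ℂ) (j : ℕ) : ℂ :=
  (Matrix.of fun α β : Fin j => s ((α : ℕ) + (β : ℕ))).det

/-- The shifted Hankel minor `D̂_j = det (s_{α+β+1})`, `0 ≤ α, β < j`; in particular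
`D̂_0 = 1`. -/
def shiftedHankelMinor (s : ℕ → ℂ) (j : ℕ) : ℂ :=
  (Matrix.of fun α β : Fin j => s ((α : ℕ) + (β : ℕ) + 1)).det

/-- The number `k` of partial quotients: `2r - 1` if `R` has a pole at `0`, and `2r`
otherwise, where `r` is the number of poles of `R`. -/
def fractionLength (R : RatFunc ℂ) (r : ℕ) : ℕ :=
  open scoped Classical in if HasPoleAt R 0 then 2 * r - 1 else 2 * r

/-- The partial quotient with index `j` of a Stieltjes fraction: `c_j z` for odd `j`, and `c_j`
for even `j`. -/
def stieltjesQuotient (c : ℕ → ℂ) (j : ℕ) : RatFunc ℂ :=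
  if Odd j then RatFunc.C (c j) * RatFunc.X else RatFunc.C (c j)

/-- The fraction `1/(t_j + 1/(t_{j+1} + ⋯ + 1/t_{j+m-1}))` with the `m` partial quotients
`t_i = stieltjesQuotient c i`. The empty fraction is `0`. -/
def stieltjesFraction (c : ℕ → ℂ) : ℕ → ℕ → RatFunc ℂ
  | _, 0 => 0
  | j, m + 1 => 1 / (stieltjesQuotient c j + stieltjesFraction c (j + 1) m)

/-- `q/p` has the Stieltjes continued fraction expansion with the coefficients `c₁, …, c_k`,
after subtraction of its value `c₀ = b₀/a₀` at infinity. -/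
def IsStieltjesExpansion (n r : ℕ) (p q : ℂ[X]) (c : ℕ → ℂ) : Prop :=
  c 0 = descCoeff n q 0 / descCoeff n p 0 ∧
  (∀ j ∈ Finset.Icc 1 (fractionLength (ratioFun p q) r), c j ≠ 0) ∧
  ratioFun p q - RatFunc.C (c 0) = stieltjesFraction c 1 (fractionLength (ratioFun p q) r)

/-- The Euclidean algorithm started with `f₀, f₁` is regular: every quotient up to the first
vanishing remainder is a polynomial of degree one. -/
inductive RegularEuclid : ℂ[X] → ℂ[X] → Prop
  | done (f : ℂ[X]) : RegularEuclid f 0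
  | step (f₀ f₁ : ℂ[X]) : f₁ ≠ 0 → (f₀ / f₁).degree = 1 → RegularEuclid f₁ (f₀ % f₁) →
      RegularEuclid f₀ f₁

/-- The entry in column `j` of the row `(0, …, 0, u₀, u₁, …)` with `shift` zeros. -/
def shiftedEntry (u : ℕ → ℂ) (shift j : ℕ) : ℂ :=
  if shift ≤ j then u (j - shift) else 0

/-- The infinite matrix of Hurwitz type `H(p, q)`, where `p` and `q` have formal degree `n`
(rows numbered from zero). If `b₀ = 0`, the row `2i` is `a₀, a₁, …` shifted by `i` and the row
`2i+1` is `b₀ = 0, b₁, …` shifted by `i`. If `b₀ ≠ 0`, the row `2i` is `b₀, b₁, …` shifted by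
`i` and the row `2i+1` is `a₀, a₁, …` shifted by `i+1`. -/
def hurwitzMatrix (n : ℕ) (p q : ℂ[X]) : Matrix ℕ ℕ ℂ :=
  Matrix.of fun i j =>
    if descCoeff n q 0 = 0 then
      if Even i then shiftedEntry (descCoeff n p) (i / 2) j
      else shiftedEntry (descCoeff n q) (i / 2) j
    else
      if Even i then shiftedEntry (descCoeff n q) (i / 2) j
      else shiftedEntry (descCoeff n p) (i / 2 + 1) j

/-- `η_j(p, q)`: the leading principal minor of order `j` of `H(p, q)`; in particular
`η_0 = 1`. -/
def eta (n : ℕ) (p q : ℂ[X]) (j : ℕ) : ℂ :=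
  (Matrix.of fun α β : Fin j => hurwitzMatrix n p q (α : ℕ) (β : ℕ)).det

/-- The infinite upper triangular Toeplitz matrix of the coefficients `g₀, g₁, …, g_l` of a
polynomial `g = g₀ z^l + ⋯ + g_l` of degree `l`. -/
def toeplitzMatrix (g : ℂ[X]) : Matrix ℕ ℕ ℂ :=
  Matrix.of fun i j => shiftedEntry (descCoeff g.natDegree g) i j

/-- The infinite matrix `J(c)`, with rows `(c,1,0,0,0,…)`, `(0,0,1,0,0,…)`, `(0,0,c,1,0,…)`,
`(0,0,0,0,1,…)`, …. -/
def matrixJ (c : ℂ) : Matrix ℕ ℕ ℂ :=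
  Matrix.of fun i j =>
    if Even i then (if j = i then c else if j = i + 1 then 1 else 0)
    else (if j = i + 1 then 1 else 0)

/-- The product of infinite matrices. It is used only with a left factor all of whose rows have
finitely many nonzero entries, so that every sum is finite. -/
def infMul (A B : Matrix ℕ ℕ ℂ) : Matrix ℕ ℕ ℂ :=
  Matrix.of fun i j => ∑ᶠ m : ℕ, A i m * B m j

/-- The product `J(c_j) J(c_{j+1}) ⋯ J(c_{j+m-1}) B`. -/
def prodJ (c : ℕ → ℂ) (B : Matrix ℕ ℕ ℂ) : ℕ → ℕ → Matrix ℕ ℕ ℂ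
  | _, 0 => B
  | j, m + 1 => infMul (matrixJ (c j)) (prodJ c B (j + 1) m)

/-- `g` is a greatest common divisor of `p` and `q`. -/
def IsGreatestCommonDivisor (g p q : ℂ[X]) : Prop :=
  g ∣ p ∧ g ∣ q ∧ ∀ d : ℂ[X], d ∣ p → d ∣ q → d ∣ g

/-- The factorization of `H(p, q)`: it is `J(c₁)⋯J(c_k) H(0,1) T(g)` if `deg q < deg p = n`,
and `J(c₀)J(c₁)⋯J(c_k) H(0,1) T(g)` if `deg q = deg p = n`, for a suitably normalized greatest
common divisor `g`. Here `H(0,1)` is the matrix of Hurwitz type of the constant polynomials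
`0` and `1`. -/
def IsHurwitzFactorization (n r : ℕ) (p q : ℂ[X]) (c : ℕ → ℂ) (g : ℂ[X]) : Prop :=
  IsGreatestCommonDivisor g p q ∧
  (q.degree < n → hurwitzMatrix n p q =
    prodJ c (infMul (hurwitzMatrix 0 0 1) (toeplitzMatrix g)) 1
      (fractionLength (ratioFun p q) r)) ∧
  (q.degree = n → hurwitzMatrix n p q =
    prodJ c (infMul (hurwitzMatrix 0 0 1) (toeplitzMatrix g)) 0
      (fractionLength (ratioFun p q) r + 1))

/-- The condition on the Hankel minors of a sequence. -/
def HankelCondition (s : ℕ → ℂ) (r : ℕ) : Prop :=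
  (∀ j ∈ Finset.Icc 1 r, hankelMinor s j ≠ 0) ∧
  (∀ j ∈ Finset.Icc 1 (r - 1), shiftedHankelMinor s j ≠ 0) ∧
  (∀ j : ℕ, r + 1 ≤ j → hankelMinor s j = 0 ∧ shiftedHankelMinor s j = 0)

/-- The formulas for `c₁, …, c_k` through Hankel minors (`k` is `2r - 1` or `2r`). -/
def HankelFormulas (s : ℕ → ℂ) (r k : ℕ) (c : ℕ → ℂ) : Prop :=
  (∀ j ∈ Finset.Icc 1 (k / 2), c (2 * j) =
    -(hankelMinor s j ^ 2 / (shiftedHankelMinor s (j - 1) * shiftedHankelMinor s j))) ∧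
  (∀ j ∈ Finset.Icc 1 r, c (2 * j - 1) =
    shiftedHankelMinor s (j - 1) ^ 2 / (hankelMinor s (j - 1) * hankelMinor s j))

/-- The formulas for the `c_j` through the minors of `H(p, q)` (`k` is `2r - 1` or `2r`). -/
def HurwitzFormulas (n : ℕ) (p q : ℂ[X]) (r k : ℕ) (c : ℕ → ℂ) : Prop :=
  (q.degree < n →
    (∀ j ∈ Finset.Icc 1 r, c (2 * j - 1) =
      eta n p q (2 * j - 1) ^ 2 / (eta n p q (2 * j - 2) * eta n p q (2 * j))) ∧
    (∀ j ∈ Finset.Icc 1 (k / 2), c (2 * j) =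
      eta n p q (2 * j) ^ 2 / (eta n p q (2 * j - 1) * eta n p q (2 * j + 1)))) ∧
  (q.degree = n →
    (∀ j ∈ Finset.Icc 1 r, c (2 * j - 1) =
      eta n p q (2 * j) ^ 2 / (eta n p q (2 * j - 1) * eta n p q (2 * j + 1))) ∧
    (∀ j ∈ Finset.Icc 0 (k / 2), c (2 * j) =
      eta n p q (2 * j + 1) ^ 2 / (eta n p q (2 * j) * eta n p q (2 * j + 2))))

end

/-! Put w = 1/z, and let a, b be the reversed polynomials of p, q, read as power series in w, so
that b/a is the expansion at infinity. All four conditions express one object (`IsStieltjesChain`):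
series U₀ = b, U₁ = a, U₂, … with U₀ = (b₀/a₀)U₁ + wU₂, with Uᵢ = cᵢUᵢ₊₁ + wUᵢ₊₂ for 1 ≤ i ≤ k, Uₖ₊₂
= 0, and Uᵢ(0) ≠ 0 for 1 ≤ i ≤ k+1. Hence cᵢ = Uᵢ(0)/Uᵢ₊₁(0).

Minors. Interleave the shifts of two consecutive series as rows. One row operation per recurrence
makes the first column trivial and passes to the next pair, so the leading minors are products of
the Uᵢ(0) (`leadingMinor_interleaved_eq_prod`). For (a, b) or (b, wa) these are the ηⱼ. After
division by a they are the minors of (1, wU₂/a), and expansion along the unit rows turns them into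
Dⱼ (order 2j) and (-1)ʲD̂ⱼ (order 2j+1). The formulas for cⱼ follow by telescoping.

Hankel condition. For j ≥ r a kernel vector of the Hankel matrix is a polynomial v with p ∣ vq, for
p, q reduced. This decides the vanishing of Dⱼ and D̂ⱼ for all j ≥ r. The remaining nonvanishing
conditions are exactly what allows the divisions producing the chain to continue
(`exists_stieltjesChain`).

The other conditions. Setting w = 1/z and rescaling Uᵢ by a power of z gives the continued fraction.
Multiplication by J(cᵢ) passes from the interleaved pair (Uᵢ₊₁, wUᵢ₊₂) to (Uᵢ, wUᵢ₊₁), which gives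
the matrix factorization. The polynomials z²ⁿ⁻ⁱ Uᵢ₊₁(1/z²) are the remainders of the Euclidean
algorithm, and a quotient has degree one exactly when no constant term vanishes. -/

/-! ### Minors of interleaved matrices as products of constant terms. -/

/-- The leading principal minor of order `j` of an infinite matrix. -/
noncomputable def leadingMinor (M : Matrix ℕ ℕ ℂ) (j : ℕ) : ℂ :=
  (Matrix.of fun α β : Fin j => M (α : ℕ) (β : ℕ)).det

/-- The infinite matrix whose rows `2i` and `2i + 1` are the coefficients of `X ^ i * U` and
`X ^ i * V`. -/
noncomputable def interleavedMatrix (U V : PowerSeries ℂ) : Matrix ℕ ℕ ℂ :=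
  Matrix.of fun i j =>
    PowerSeries.coeff j (PowerSeries.X ^ (i / 2) * if Even i then U else V)

theorem leadingMinor_succ_of_column_zero {M : Matrix ℕ ℕ ℂ} {j : ℕ}
    (h : ∀ i, M (i + 1) 0 = 0) :
    leadingMinor M (j + 1) = M 0 0 * leadingMinor (fun a b => M (a + 1) (b + 1)) j := by
  unfold leadingMinor
  rw [Matrix.det_succ_column_zero, Fin.sum_univ_succ]
  simp [h]
  left
  congr 1

/-- The rows are U, XV, XU, X²V, …. Subtracting c times the preceding row from each later even row
replaces XᵐU by Xᵐ⁺¹W. The first column is then zero below U(0), and deleting it with the first row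
leaves V, XW, XV, X²W, …. -/
theorem leadingMinor_interleaved_succ {U V W : PowerSeries ℂ} {c : ℂ}
    (h : U = PowerSeries.C c * V + PowerSeries.X * W) (j : ℕ) :
    leadingMinor (interleavedMatrix U (PowerSeries.X * V)) (j + 1) =
      PowerSeries.constantCoeff U *
        leadingMinor (interleavedMatrix V (PowerSeries.X * W)) j := by
  set B : Matrix ℕ ℕ ℂ := fun a b => match a with
    | 0 => PowerSeries.coeff b U
    | a + 1 => PowerSeries.coeff b
        (PowerSeries.X * (PowerSeries.X ^ (a / 2) * if Even a then V else PowerSeries.X * W))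
    with hB
  have h1 : leadingMinor (interleavedMatrix U (PowerSeries.X * V)) (j + 1) =
      leadingMinor B (j + 1) := by
    unfold leadingMinor
    apply Matrix.det_eq_of_forall_row_eq_smul_add_pred
      (fun i : Fin j => if Even (i : ℕ) then 0 else c)
    · intro b
      simp [hB, interleavedMatrix]
    · intro i b
      obtain ⟨m, hm | hm⟩ := Nat.even_or_odd' (i : ℕ)
      · have e1 : (2 * m + 1) / 2 = m := by omega
        have e2 : 2 * m / 2 = m := by omega
        have e3 : ¬ Even (2 * m + 1) := by simp
        simp only [Matrix.of_apply, hB, interleavedMatrix, Fin.val_succ, Fin.val_castSucc, hm,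
          e1, e2, e3, if_false, even_two, Even.mul_right, if_true, zero_mul, add_zero]
        congr 1
        ring
      · have e1 : (2 * m + 1 + 1) / 2 = m + 1 := by omega
        have e2 : (2 * m + 1) / 2 = m := by omega
        have e3 : ¬ Even (2 * m + 1) := by simp
        have e4 : Even (2 * m + 1 + 1) := by simp [Nat.even_add_one]
        simp only [Matrix.of_apply, hB, interleavedMatrix, Fin.val_succ, Fin.val_castSucc, hm,
          e1, e2, e3, e4, if_false, if_true]
        rw [← PowerSeries.coeff_C_mul, ← map_add]
        congr 1
        rw [h]
        ring
  rw [h1, leadingMinor_succ_of_column_zero]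
  · simp only [hB, PowerSeries.coeff_zero_eq_constantCoeff, PowerSeries.coeff_succ_X_mul]
    rfl
  · intro i
    simp only [hB, PowerSeries.coeff_zero_X_mul]

theorem leadingMinor_interleaved_one (U V : PowerSeries ℂ) :
    leadingMinor (interleavedMatrix U V) 1 = PowerSeries.constantCoeff U := by
  simp [leadingMinor, interleavedMatrix]

theorem leadingMinor_interleaved_two (U V : PowerSeries ℂ) :
    leadingMinor (interleavedMatrix U (PowerSeries.X * V)) 2 =
      PowerSeries.constantCoeff U * PowerSeries.constantCoeff V := by
  rw [leadingMinor_succ_of_column_zero]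
  · simp [interleavedMatrix, leadingMinor]
  · intro i
    rcases Nat.even_or_odd' i with ⟨m, hm | hm⟩
    · simp [interleavedMatrix, hm]
    · have : (2 * m + 1 + 1) / 2 = m + 1 := by omega
      have h : Even (2 * m + 1 + 1) := by simp [Nat.even_add_one]
      simp [interleavedMatrix, hm, this, h]

theorem leadingMinor_interleaved_eq_prod (j : ℕ) :
    ∀ (U : ℕ → PowerSeries ℂ) (c : ℕ → ℂ),
      (∀ i, i + 2 < j → U i = PowerSeries.C (c i) * U (i + 1) + PowerSeries.X * U (i + 2)) →
      leadingMinor (interleavedMatrix (U 0) (PowerSeries.X * U 1)) j =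
        ∏ i ∈ Finset.range j, PowerSeries.constantCoeff (U i) := by
  induction j with
  | zero => simp [leadingMinor]
  | succ j ih =>
    intro U c h
    match j with
    | 0 => simp [leadingMinor_interleaved_one]
    | 1 => simp [leadingMinor_interleaved_two, Finset.prod_range_succ]
    | j + 2 =>
      rw [leadingMinor_interleaved_succ (h 0 (by omega)),
        ih (fun i => U (i + 1)) (fun i => c (i + 1)) (fun i hi => h (i + 1) (by omega)),
        Finset.prod_range_succ' _ (j + 2), mul_comm]

/-- The same reduction, iterated until the second series of the pair vanishes and a zero row
appears. -/
theorem leadingMinor_interleaved_eq_zero (m : ℕ) :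
    ∀ (U : ℕ → PowerSeries ℂ) (c : ℕ → ℂ) (j : ℕ),
      (∀ i, i < m → U i = PowerSeries.C (c i) * U (i + 1) + PowerSeries.X * U (i + 2)) →
      U (m + 1) = 0 → m + 2 ≤ j →
      leadingMinor (interleavedMatrix (U 0) (PowerSeries.X * U 1)) j = 0 := by
  induction m with
  | zero =>
    intro U c j _ h hj
    apply Matrix.det_eq_zero_of_row_eq_zero (⟨1, by omega⟩ : Fin j)
    intro b
    simp [interleavedMatrix, h]
  | succ m ih =>
    intro U c j h h0 hj
    obtain ⟨j, rfl⟩ : ∃ i, j = i + 1 := ⟨j - 1, by omega⟩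
    rw [leadingMinor_interleaved_succ (h 0 (by omega)),
      ih (fun i => U (i + 1)) (fun i => c (i + 1)) j (fun i hi => h (i + 1) (by omega)) h0
        (by omega), mul_zero]

/-! ### Hankel minors as minors of an interleaved matrix. -/

/-- The sign of the reversal is found by expanding the reversed identity matrix. The exponent stays
a sum so that it cancels the sign in `leadingMinor_unitInterleaved`. -/
theorem det_submatrix_rev (n : ℕ) (M : Matrix (Fin n) (Fin n) ℂ) :
    (M.submatrix Fin.rev id).det = (-1) ^ (∑ i ∈ Finset.range n, i) * M.det := by
  have key : ∀ n : ℕ, ((1 : Matrix (Fin n) (Fin n) ℂ).submatrix Fin.rev id).det =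
      (-1) ^ (∑ i ∈ Finset.range n, i) := by
    intro n
    induction n with
    | zero => simp
    | succ n ih =>
      rw [Matrix.det_succ_column_zero, Finset.sum_eq_single (Fin.last n)]
      · have : (((1 : Matrix (Fin (n + 1)) (Fin (n + 1)) ℂ).submatrix Fin.rev id).submatrix
            (Fin.last n).succAbove Fin.succ) =
            (1 : Matrix (Fin n) (Fin n) ℂ).submatrix Fin.rev id := by
          ext i j
          simp [Matrix.one_apply, Fin.rev_castSucc]
        rw [this, ih, Finset.sum_range_succ, pow_add]
        have h0 : (1 : Matrix (Fin (n + 1)) (Fin (n + 1)) ℂ) (Fin.last n).rev (id 0) = 1 := by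
          rw [Fin.rev_last]
          exact Matrix.one_apply_eq 0
        simp [mul_comm, h0]
      · intro b _ hb
        have : Fin.rev b ≠ 0 := by
          intro h
          apply hb
          rw [← Fin.rev_rev b, h, Fin.rev_zero]
        simp [this]
      · simp
  have h1 := Matrix.det_permute (Fin.revPerm (n := n)) M
  have h2 := Matrix.det_permute (Fin.revPerm (n := n)) (1 : Matrix (Fin n) (Fin n) ℂ)
  rw [Matrix.det_one, mul_one] at h2
  rw [← key n]
  change (M.submatrix (Fin.revPerm (n := n)) id).det =
    ((1 : Matrix (Fin n) (Fin n) ℂ).submatrix (Fin.revPerm (n := n)) id).det * _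
  rw [h2, h1]

/-- The infinite matrix whose first `l` rows are `A₀, …, A_{l-1}` without their first `l`
entries, followed by the rows `e₀, A_l, e₁, A_{l+1}, …`, where the `A_i` are again taken without
their first `l` entries. -/
def unitInterleavedMatrix (A : ℕ → ℕ → ℂ) (l : ℕ) : Matrix ℕ ℕ ℂ :=
  Matrix.of fun i j =>
    if i < l then A i (l + j)
    else if Even (i - l) then (if j = (i - l) / 2 then 1 else 0)
    else A (l + (i - l) / 2) (l + j)

/-- Row l is the unit vector e₀. Expansion along it removes the first column, contributes (-1)ˡ, and
turns each later eᵢ₊₁ into eᵢ. -/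
theorem leadingMinor_unitInterleaved_succ (A : ℕ → ℕ → ℂ) {l N : ℕ} (hl : l ≤ N) :
    leadingMinor (unitInterleavedMatrix A l) (N + 1) =
      (-1) ^ l * leadingMinor (unitInterleavedMatrix A (l + 1)) N := by
  unfold leadingMinor
  rw [Matrix.det_succ_row _ (⟨l, by omega⟩ : Fin (N + 1)), Finset.sum_eq_single 0]
  · have : (Matrix.of fun α β : Fin (N + 1) =>
        unitInterleavedMatrix A l (α : ℕ) (β : ℕ)).submatrix
          (Fin.succAbove (⟨l, by omega⟩ : Fin (N + 1))) (Fin.succAbove 0) =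
        Matrix.of fun α β : Fin N => unitInterleavedMatrix A (l + 1) (α : ℕ) (β : ℕ) := by
      ext α β
      simp only [Matrix.submatrix_apply, Matrix.of_apply, Fin.succAbove_zero, Fin.val_succ,
        unitInterleavedMatrix]
      by_cases h : (α : ℕ) < l
      · have h1 : ((Fin.succAbove (⟨l, by omega⟩ : Fin (N + 1)) α : Fin (N + 1)) : ℕ) = α := by
          rw [Fin.succAbove_of_castSucc_lt _ _ (by simpa [Fin.lt_def] using h)]
          simp
        rw [h1, if_pos h, if_pos (by omega), show l + 1 + (β : ℕ) = l + (β + 1) by ring]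
      · have h1 : ((Fin.succAbove (⟨l, by omega⟩ : Fin (N + 1)) α : Fin (N + 1)) : ℕ) =
            α + 1 := by
          rw [Fin.succAbove_of_le_castSucc _ _ (by simpa [Fin.le_def] using h)]
          simp
        rw [h1, if_neg (by omega)]
        obtain ⟨d, hd⟩ : ∃ d, (α : ℕ) = l + d := ⟨α - l, by omega⟩
        rw [hd]
        match d with
        | 0 => simp [show l + 1 + (β : ℕ) = l + (β + 1) by ring]
        | d + 1 =>
          rw [if_neg (show ¬ l + (d + 1) < l + 1 by omega)]
          have e1 : l + (d + 1) + 1 - l = d + 2 := by omega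
          have e2 : l + (d + 1) - (l + 1) = d := by omega
          have e3 : (d + 2) / 2 = d / 2 + 1 := by omega
          have e4 : Even (d + 2) ↔ Even d := by simp [Nat.even_add]
          simp only [e1, e2, e3, e4, add_left_inj]
          rw [show l + 1 + (β : ℕ) = l + (β + 1) by ring,
            show l + 1 + d / 2 = l + (d / 2 + 1) by ring]
    rw [this]
    simp only [Matrix.of_apply, unitInterleavedMatrix, lt_irrefl, if_false, Nat.sub_self,
      Even.zero, if_true, Nat.zero_div, Fin.val_zero, add_zero, mul_one]
  · intro b _ hb
    have : (b : ℕ) ≠ 0 := fun h => hb (Fin.ext h)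
    simp [unitInterleavedMatrix, this]
  · simp

theorem leadingMinor_unitInterleaved (A : ℕ → ℕ → ℂ) (l : ℕ) :
    ∀ N, l ≤ N + 1 → leadingMinor (unitInterleavedMatrix A 0) (N + l) =
      (-1) ^ (∑ i ∈ Finset.range l, i) * leadingMinor (unitInterleavedMatrix A l) N := by
  induction l with
  | zero => simp
  | succ l ih =>
    intro N hN
    rw [show N + (l + 1) = N + 1 + l by ring, ih (N + 1) (by omega),
      leadingMinor_unitInterleaved_succ A (by omega), Finset.sum_range_succ, pow_add, mul_assoc]

theorem interleavedMatrix_one_eq (F : PowerSeries ℂ) :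
    interleavedMatrix 1 F =
      unitInterleavedMatrix (fun i j => PowerSeries.coeff j (PowerSeries.X ^ i * F)) 0 := by
  ext i j
  by_cases h : Even i <;> simp [interleavedMatrix, unitInterleavedMatrix, h, PowerSeries.coeff_X_pow]

/-- After the j unit rows are removed, the rows of a Hankel matrix remain in reverse order. The
expansion and the reversal have the same sign. In odd order one more unit row is removed, which
shifts the Hankel matrix by one and leaves the sign (-1)ʲ. -/
theorem leadingMinor_interleaved_one_even (F : PowerSeries ℂ) (j : ℕ) :
    leadingMinor (interleavedMatrix 1 F) (2 * j) =
      hankelMinor (fun i => PowerSeries.coeff (i + 1) F) j := by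
  rw [interleavedMatrix_one_eq, two_mul, leadingMinor_unitInterleaved _ _ _ (by omega)]
  have : leadingMinor (unitInterleavedMatrix
      (fun i j => PowerSeries.coeff j (PowerSeries.X ^ i * F)) j) j =
      ((Matrix.of fun α β : Fin j =>
        PowerSeries.coeff ((α : ℕ) + (β : ℕ) + 1) F).submatrix Fin.rev id).det := by
    unfold leadingMinor
    congr 1
    ext α β
    have h := α.2
    simp only [Matrix.of_apply, unitInterleavedMatrix, α.2, if_true, Matrix.submatrix_apply,
      PowerSeries.coeff_X_pow_mul', id, Fin.val_rev]
    rw [if_pos (by omega)]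
    congr 2
    omega
  rw [this, det_submatrix_rev, ← mul_assoc, ← pow_add, Even.neg_one_pow ⟨_, rfl⟩, one_mul]
  rfl

theorem leadingMinor_interleaved_one_odd (F : PowerSeries ℂ) (j : ℕ) :
    leadingMinor (interleavedMatrix 1 F) (2 * j + 1) =
      (-1) ^ j * shiftedHankelMinor (fun i => PowerSeries.coeff (i + 1) F) j := by
  rw [interleavedMatrix_one_eq, show 2 * j + 1 = j + (j + 1) by ring,
    leadingMinor_unitInterleaved _ _ _ (by omega)]
  have : leadingMinor (unitInterleavedMatrix
      (fun i j => PowerSeries.coeff j (PowerSeries.X ^ i * F)) (j + 1)) j =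
      ((Matrix.of fun α β : Fin j =>
        PowerSeries.coeff ((α : ℕ) + (β : ℕ) + 1 + 1) F).submatrix Fin.rev id).det := by
    unfold leadingMinor
    congr 1
    ext α β
    have h := α.2
    simp only [Matrix.of_apply, unitInterleavedMatrix, Matrix.submatrix_apply,
      PowerSeries.coeff_X_pow_mul', id, Fin.val_rev]
    rw [if_pos (by omega), if_pos (by omega)]
    congr 2
    omega
  rw [this, det_submatrix_rev, ← mul_assoc, ← pow_add, Finset.sum_range_succ,
    show ∀ a b : ℕ, a + b + a = b + 2 * a by intros; ring, pow_add, pow_mul]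
  simp [shiftedHankelMinor]

/-! ### Reversed polynomials and the expansion at infinity. -/

theorem coeff_reflect_of_le {N i : ℕ} (f : ℂ[X]) (h : i ≤ N) :
    (f.reflect N).coeff i = f.coeff (N - i) := by
  rw [coeff_reflect, revAt_le h]

theorem natDegree_reflect_le_of_le {N : ℕ} {f : ℂ[X]} (h : f.natDegree ≤ N) :
    (f.reflect N).natDegree ≤ N :=
  natDegree_reflect_le.trans (max_le le_rfl h)

theorem mk_descCoeff {n : ℕ} {f : ℂ[X]} (h : f.natDegree ≤ n) :
    PowerSeries.mk (descCoeff n f) = (f.reflect n : PowerSeries ℂ) := by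
  ext i
  rw [PowerSeries.coeff_mk, Polynomial.coeff_coe, descCoeff]
  split_ifs with hi
  · rw [coeff_reflect_of_le f hi]
  · rw [coeff_eq_zero_of_natDegree_lt]
    exact (natDegree_reflect_le_of_le h).trans_lt (by omega)

theorem descCoeff_zero (n : ℕ) (f : ℂ[X]) : descCoeff n f 0 = f.coeff n := by
  simp [descCoeff]

theorem constantCoeff_reflect (n : ℕ) (f : ℂ[X]) :
    PowerSeries.constantCoeff (f.reflect n : PowerSeries ℂ) = f.coeff n := by
  rw [← PowerSeries.coeff_zero_eq_constantCoeff_apply, Polynomial.coeff_coe,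
    coeff_reflect_of_le f (Nat.zero_le _), Nat.sub_zero]

theorem expansionAtInfinity_eq {n : ℕ} {p q : ℂ[X]} (hp : p.natDegree ≤ n)
    (hq : q.natDegree ≤ n) :
    expansionAtInfinity n p q =
      (q.reflect n : PowerSeries ℂ) * (p.reflect n : PowerSeries ℂ)⁻¹ := by
  rw [expansionAtInfinity, mk_descCoeff hp, mk_descCoeff hq]

theorem expansionAtInfinity_mul_left {n m : ℕ} {g p q : ℂ[X]} (hg : g.natDegree = m)
    (hg0 : g ≠ 0) (hp : p.natDegree ≤ n) (hq : q.natDegree ≤ n) :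
    expansionAtInfinity (m + n) (g * p) (g * q) = expansionAtInfinity n p q := by
  rw [expansionAtInfinity_eq (natDegree_mul_le.trans (by omega))
    (natDegree_mul_le.trans (by omega)), expansionAtInfinity_eq hp hq,
    reflect_mul _ _ hg.le hp, reflect_mul _ _ hg.le hq]
  have h : PowerSeries.constantCoeff (g.reflect m : PowerSeries ℂ) ≠ 0 := by
    rw [constantCoeff_reflect, ← hg]
    exact leadingCoeff_ne_zero.2 hg0
  push_cast
  rw [PowerSeries.mul_inv_rev]
  calc _ = ((g.reflect m : PowerSeries ℂ) * (g.reflect m : PowerSeries ℂ)⁻¹) *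
        ((q.reflect n : PowerSeries ℂ) * (p.reflect n : PowerSeries ℂ)⁻¹) := by ring
    _ = _ := by rw [PowerSeries.mul_inv_cancel _ h, one_mul]

/-- Row m of the Hankel matrix applied to the coefficients of v is the coefficient of 1/zᵐ⁺¹ in v
times the expansion. -/
theorem coeff_reflect_mul_eq_sum (E : PowerSeries ℂ) {d : ℕ} {v : ℂ[X]} (hv : v.natDegree ≤ d)
    (m : ℕ) :
    PowerSeries.coeff (d + 1 + m) ((v.reflect d : PowerSeries ℂ) * E) =
      ∑ i ∈ Finset.range (d + 1), v.coeff i * PowerSeries.coeff (m + i + 1) E := by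
  rw [PowerSeries.coeff_mul, Finset.Nat.sum_antidiagonal_eq_sum_range_succ
    (fun i j => PowerSeries.coeff i (v.reflect d : PowerSeries ℂ) * PowerSeries.coeff j E),
    ← Finset.sum_subset (Finset.range_subset_range.2 (by omega : d + 1 ≤ (d + 1 + m).succ)),
    ← Finset.sum_range_reflect]
  · refine Finset.sum_congr rfl fun i hi => ?_
    rw [Finset.mem_range] at hi
    rw [Polynomial.coeff_coe, coeff_reflect_of_le _ (by omega),
      show d - (d + 1 - 1 - i) = i by omega,
      show d + 1 + m - (d + 1 - 1 - i) = m + i + 1 by omega]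
  · intro i _ hi
    rw [Finset.mem_range] at hi
    rw [Polynomial.coeff_coe, coeff_eq_zero_of_natDegree_lt, zero_mul]
    exact (natDegree_reflect_le_of_le hv).trans_lt (by omega)

/-- Divisibility means that vq/p is a polynomial, so its expansion has no negative powers of z.
Since deg p = r, the vanishing of the first r of these already suffices. -/
theorem dvd_mul_iff_coeff_eq_zero {r d : ℕ} {p q v : ℂ[X]} (hp : p.natDegree = r) (hp0 : p ≠ 0)
    (hq : q.natDegree ≤ r) (hv : v.natDegree ≤ d) (N : ℕ) (hN : r ≤ N) :
    p ∣ v * q ↔ ∀ m < N, PowerSeries.coeff (d + 1 + m)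
      ((v.reflect d : PowerSeries ℂ) * expansionAtInfinity r p q) = 0 := by
  have ha : PowerSeries.constantCoeff (p.reflect r : PowerSeries ℂ) ≠ 0 := by
    rw [constantCoeff_reflect, ← hp]
    exact leadingCoeff_ne_zero.2 hp0
  rw [expansionAtInfinity_eq hp.le hq]
  set E := (q.reflect r : PowerSeries ℂ) * (p.reflect r : PowerSeries ℂ)⁻¹ with hE
  have hEa : (p.reflect r : PowerSeries ℂ) * E = (q.reflect r : PowerSeries ℂ) := by
    rw [hE, mul_left_comm, PowerSeries.mul_inv_cancel _ ha, mul_one]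
  constructor
  · rintro ⟨w, hw⟩ m -
    have hwd : w.natDegree ≤ d := by
      by_cases hw0 : w = 0
      · simp [hw0]
      have := natDegree_mul hp0 hw0
      rw [← hw] at this
      have h2 := natDegree_mul_le (p := v) (q := q)
      omega
    have h1 : v.reflect d * q.reflect r = p.reflect r * w.reflect d := by
      rw [← reflect_mul _ _ hv hq, hw, ← reflect_mul _ _ hp.le hwd, add_comm]
    have h2 : (v.reflect d : PowerSeries ℂ) * E = (w.reflect d : PowerSeries ℂ) := by
      have h3 : (p.reflect r : PowerSeries ℂ) ≠ 0 := fun h => by simp [h] at ha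
      apply mul_left_cancel₀ h3
      rw [mul_left_comm, hEa]
      exact_mod_cast h1
    rw [h2, Polynomial.coeff_coe, coeff_eq_zero_of_natDegree_lt]
    exact (natDegree_reflect_le_of_le hwd).trans_lt (by omega)
  · intro h
    set Q : ℂ[X] := PowerSeries.trunc (d + 1) ((v.reflect d : PowerSeries ℂ) * E) with hQ
    have hQd : Q.natDegree ≤ d := by
      exact Nat.lt_succ_iff.1 (PowerSeries.natDegree_trunc_lt _ d)
    obtain ⟨T, hT⟩ : (PowerSeries.X : PowerSeries ℂ) ^ (d + 1 + r) ∣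
        (v.reflect d : PowerSeries ℂ) * E - (Q : PowerSeries ℂ) := by
      rw [PowerSeries.X_pow_dvd_iff]
      intro i hi
      rw [map_sub, Polynomial.coeff_coe, hQ, PowerSeries.coeff_trunc]
      split_ifs with h1
      · rw [sub_self]
      · obtain ⟨m, rfl⟩ : ∃ m, i = d + 1 + m := ⟨i - (d + 1), by omega⟩
        rw [h m (by omega), sub_zero]
    have h0 : v.reflect d * q.reflect r = p.reflect r * Q := by
      rw [← sub_eq_zero]
      have hd : (v.reflect d * q.reflect r - p.reflect r * Q).natDegree ≤ d + r := by
        refine (natDegree_sub_le _ _).trans (max_le (natDegree_mul_le.trans ?_)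
          (natDegree_mul_le.trans ?_))
        · exact add_le_add (natDegree_reflect_le_of_le hv) (natDegree_reflect_le_of_le hq)
        · have := natDegree_reflect_le_of_le hp.le
          omega
      have hcoe : ((v.reflect d * q.reflect r - p.reflect r * Q : ℂ[X]) : PowerSeries ℂ) =
          PowerSeries.X ^ (d + 1 + r) * ((p.reflect r : PowerSeries ℂ) * T) := by
        push_cast
        rw [← hEa]
        linear_combination (p.reflect r : PowerSeries ℂ) * hT
      ext i
      rw [coeff_zero]
      by_cases hi : i ≤ d + r
      · rw [← Polynomial.coeff_coe, hcoe, PowerSeries.coeff_X_pow_mul', if_neg (by omega)]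
      · exact coeff_eq_zero_of_natDegree_lt (by omega)
    refine ⟨Q.reflect d, ?_⟩
    have h1 := congrArg (reflect (d + r)) h0
    rw [reflect_mul _ _ (natDegree_reflect_le_of_le hv) (natDegree_reflect_le_of_le hq),
      add_comm d r, reflect_mul _ _ (natDegree_reflect_le_of_le hp.le) hQd] at h1
    simpa using h1

/-! ### Hankel minors of order at least the number of poles. -/

theorem det_hankel_eq_zero_iff (s : ℕ → ℂ) (j : ℕ) :
    (Matrix.of fun α β : Fin j => s ((α : ℕ) + (β : ℕ))).det = 0 ↔
      ∃ v : ℂ[X], v ≠ 0 ∧ v.degree < j ∧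
        ∀ m < j, ∑ i ∈ Finset.range j, v.coeff i * s (m + i) = 0 := by
  rw [← Matrix.exists_mulVec_eq_zero_iff]
  constructor
  · rintro ⟨v, hv, h⟩
    refine ⟨((degreeLTEquiv ℂ j).symm v : ℂ[X]), ?_, ?_, ?_⟩
    · intro h0
      apply hv
      simpa using h0
    · exact mem_degreeLT.1 ((degreeLTEquiv ℂ j).symm v).2
    · intro m hm
      have h1 := congrFun h ⟨m, hm⟩
      rw [Finset.sum_range]
      have h2 : ∀ i : Fin j, ((degreeLTEquiv ℂ j).symm v : ℂ[X]).coeff i = v i := by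
        intro i
        exact congrFun ((degreeLTEquiv ℂ j).apply_symm_apply v) i
      simp only [h2]
      simpa [Matrix.mulVec, dotProduct, mul_comm] using h1
  · rintro ⟨v, hv, hd, h⟩
    refine ⟨degreeLTEquiv ℂ j ⟨v, mem_degreeLT.2 hd⟩, ?_, ?_⟩
    · intro h0
      apply hv
      simpa using h0
    · ext m
      have h1 := h m m.2
      rw [Finset.sum_range] at h1
      rw [Pi.zero_apply, ← h1]
      simp [Matrix.mulVec, dotProduct, degreeLTEquiv, mul_comm]

/-- By coprimality the kernel consists of the multiples of p of degree below j, and it is nonzero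
precisely when r < j. -/
theorem hankelMinor_eq_zero_iff {r : ℕ} {p q : ℂ[X]} (hp : p.natDegree = r) (hp0 : p ≠ 0)
    (hq : q.natDegree ≤ r) (hc : IsCoprime p q) {j : ℕ} (hj : r ≤ j) :
    hankelMinor (laurentCoeff r p q) j = 0 ↔ r < j := by
  have key : hankelMinor (laurentCoeff r p q) j = 0 ↔
      ∃ v : ℂ[X], v ≠ 0 ∧ v.degree < j ∧ p ∣ v := by
    unfold hankelMinor
    rw [det_hankel_eq_zero_iff]
    refine exists_congr fun v => and_congr_right fun hv => and_congr_right fun hd => ?_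
    rw [← natDegree_lt_iff_degree_lt hv] at hd
    obtain ⟨d, rfl⟩ : ∃ d, j = d + 1 := ⟨j - 1, by omega⟩
    rw [← (⟨hc.dvd_of_dvd_mul_right, fun h => h.mul_right q⟩ : p ∣ _ * q ↔ p ∣ _), dvd_mul_iff_coeff_eq_zero hp hp0 hq (Nat.lt_succ_iff.1 hd) (d + 1) hj]
    simp only [coeff_reflect_mul_eq_sum _ (Nat.lt_succ_iff.1 hd)]
    rfl
  rw [key]
  constructor
  · rintro ⟨v, hv, hd, hpv⟩
    rw [← natDegree_lt_iff_degree_lt hv] at hd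
    exact hp ▸ (natDegree_le_of_dvd hpv hv).trans_lt hd
  · intro h
    exact ⟨p, hp0, by rwa [← natDegree_lt_iff_degree_lt hp0, hp], dvd_rfl⟩

theorem shiftedHankelMinor_eq_zero_iff {r : ℕ} {p q : ℂ[X]} (hp : p.natDegree = r) (hp0 : p ≠ 0)
    (hq : q.natDegree ≤ r) (hc : IsCoprime p q) {j : ℕ} (hj : r ≤ j) :
    shiftedHankelMinor (laurentCoeff r p q) j = 0 ↔ r < j ∨ p.IsRoot 0 := by
  have key : shiftedHankelMinor (laurentCoeff r p q) j = 0 ↔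
      ∃ v : ℂ[X], v ≠ 0 ∧ v.degree < j ∧ p ∣ X * v := by
    unfold shiftedHankelMinor
    rw [det_hankel_eq_zero_iff (fun i => laurentCoeff r p q (i + 1))]
    refine exists_congr fun v => and_congr_right fun hv => and_congr_right fun hd => ?_
    rw [← natDegree_lt_iff_degree_lt hv] at hd
    -- The shifted Hankel matrix acts on v as the unshifted sequence acts on Xv. Hence the condition
    -- becomes p ∣ Xv, which has an extra solution v = p/X when p(0) = 0.
    have hd' : (X * v).natDegree ≤ j := by
      rw [natDegree_X_mul hv]
      exact hd
    rw [← (⟨hc.dvd_of_dvd_mul_right, fun h => h.mul_right q⟩ : p ∣ _ * q ↔ p ∣ _), dvd_mul_iff_coeff_eq_zero hp hp0 hq hd' j hj]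
    simp only [coeff_reflect_mul_eq_sum _ hd']
    simp only [Finset.sum_range_succ' _ j, coeff_X_mul, coeff_X_mul_zero, zero_mul, add_zero]
    rfl
  rw [key]
  constructor
  · rintro ⟨v, hv, hd, hpv⟩
    rw [← natDegree_lt_iff_degree_lt hv] at hd
    by_contra! h
    have hX : IsCoprime p X := by
      rw [isCoprime_comm, (irreducible_X : Irreducible (X : ℂ[X])).coprime_iff_not_dvd,
        X_dvd_iff, coeff_zero_eq_eval_zero]
      exact h.2
    have := natDegree_le_of_dvd (hX.dvd_of_dvd_mul_left hpv) hv
    omega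
  · rintro (h | h)
    · exact ⟨p, hp0, by rwa [← natDegree_lt_iff_degree_lt hp0, hp], dvd_mul_left _ _⟩
    · obtain ⟨v, rfl⟩ : X ∣ p := by
        rwa [X_dvd_iff, coeff_zero_eq_eval_zero]
      have hv : v ≠ 0 := right_ne_zero_of_mul hp0
      refine ⟨v, hv, ?_, dvd_rfl⟩
      rw [natDegree_X_mul hv] at hp
      rw [← natDegree_lt_iff_degree_lt hv]
      omega

/-! ### Stieltjes chains and the formulas for their coefficients. -/

/-- The chain of power series (in `1/z`) of the Euclidean algorithm that produces a Stieltjes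
fraction of length `k` with the coefficients `c₁, …, c_k` from the expansions `a` of `p` and `b`
of `q`. -/
structure IsStieltjesChain (a b : PowerSeries ℂ) (c : ℕ → ℂ) (k : ℕ) (U : ℕ → PowerSeries ℂ) :
    Prop where
  zero : U 0 = b
  one : U 1 = a
  rel_zero : b = PowerSeries.C (PowerSeries.constantCoeff b / PowerSeries.constantCoeff a) * a +
    PowerSeries.X * U 2
  rel : ∀ i, 1 ≤ i → i ≤ k →
    U i = PowerSeries.C (c i) * U (i + 1) + PowerSeries.X * U (i + 2)
  last : U (k + 2) = 0
  ne_zero : ∀ i, 1 ≤ i → i ≤ k + 1 → PowerSeries.constantCoeff (U i) ≠ 0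

theorem sq_prod_div_prod_mul_prod {v : ℕ → ℂ} {N : ℕ} (h : ∀ i ≤ N + 1, v i ≠ 0) :
    (∏ i ∈ Finset.range (N + 1), v i) ^ 2 /
      ((∏ i ∈ Finset.range N, v i) * ∏ i ∈ Finset.range (N + 2), v i) = v N / v (N + 1) := by
  have h0 : ∏ i ∈ Finset.range N, v i ≠ 0 := by
    rw [Finset.prod_ne_zero_iff]
    intro i hi
    rw [Finset.mem_range] at hi
    exact h i (by omega)
  have h1 := h N (by omega)
  have h2 := h (N + 1) le_rfl
  rw [Finset.prod_range_succ _ (N + 1), Finset.prod_range_succ _ N]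
  field_simp

/-- Subtracting the value κ at infinity changes none of s₀, s₁, …. -/
theorem coeff_succ_mul_inv {a b W : PowerSeries ℂ} {κ : ℂ}
    (ha : PowerSeries.constantCoeff a ≠ 0) (h : b = PowerSeries.C κ * a + PowerSeries.X * W) :
    (fun i => PowerSeries.coeff (i + 1) (PowerSeries.X * (W * a⁻¹))) =
      fun i => PowerSeries.coeff (i + 1) (b * a⁻¹) := by
  funext i
  have h2 : b * a⁻¹ = PowerSeries.C κ + PowerSeries.X * (W * a⁻¹) := by
    linear_combination a⁻¹ * h + PowerSeries.C κ * PowerSeries.mul_inv_cancel a ha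
  rw [h2, map_add, PowerSeries.coeff_C, if_neg (Nat.succ_ne_zero i), zero_add]

namespace IsStieltjesChain

variable {a b : PowerSeries ℂ} {c : ℕ → ℂ} {k : ℕ} {U : ℕ → PowerSeries ℂ}

theorem coeff_eq (h : IsStieltjesChain a b c k U) {i : ℕ} (h1 : 1 ≤ i) (hk : i ≤ k) :
    c i = PowerSeries.constantCoeff (U i) / PowerSeries.constantCoeff (U (i + 1)) := by
  rw [eq_div_iff (h.ne_zero _ (by omega) (by omega)), h.rel i h1 hk]
  simp

theorem coeff_ne_zero (h : IsStieltjesChain a b c k U) {i : ℕ} (h1 : 1 ≤ i) (hk : i ≤ k) :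
    c i ≠ 0 := by
  rw [h.coeff_eq h1 hk]
  exact div_ne_zero (h.ne_zero _ h1 (by omega)) (h.ne_zero _ (by omega) (by omega))

theorem leadingMinor_eq_prod (h : IsStieltjesChain a b c k U) {N : ℕ} (hN : N ≤ k + 1) :
    leadingMinor (interleavedMatrix a (PowerSeries.X * U 2)) N =
      ∏ i ∈ Finset.range N, PowerSeries.constantCoeff (U (i + 1)) := by
  have := leadingMinor_interleaved_eq_prod N (fun i => U (i + 1)) (fun i => c (i + 1))
    fun i hi => h.rel (i + 1) (by omega) (by omega)
  rwa [zero_add, h.one] at this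

theorem leadingMinor_eq_prod' (h : IsStieltjesChain a b c k U) {N : ℕ} (hN : N ≤ k + 2) :
    leadingMinor (interleavedMatrix b (PowerSeries.X * a)) N =
      ∏ i ∈ Finset.range N, PowerSeries.constantCoeff (U i) := by
  -- A chain leaves `c 0` free, so the coefficient of the initial relation is inserted by hand.
  have := leadingMinor_interleaved_eq_prod N U (fun i => if i = 0 then
    PowerSeries.constantCoeff b / PowerSeries.constantCoeff a else c i) fun i hi => ?_
  · rwa [h.zero, h.one] at this
  · split_ifs with h0
    · rw [h0, h.zero, zero_add, h.one, zero_add, ← h.rel_zero]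
    · exact h.rel i (by omega) (by omega)

theorem one_mul_inv (h : IsStieltjesChain a b c k U) : U 1 * a⁻¹ = 1 := by
  rw [h.one, PowerSeries.mul_inv_cancel]
  rw [← h.one]
  exact h.ne_zero 1 le_rfl (by omega)

theorem rel_mul_inv (h : IsStieltjesChain a b c k U) {i : ℕ} (h1 : 1 ≤ i) (hk : i ≤ k) :
    U i * a⁻¹ = PowerSeries.C (c i) * (U (i + 1) * a⁻¹) +
      PowerSeries.X * (U (i + 2) * a⁻¹) := by
  rw [h.rel i h1 hk]
  ring

theorem normalized_eq_prod (h : IsStieltjesChain a b c k U) {N : ℕ} (hN : N ≤ k + 1) :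
    leadingMinor (interleavedMatrix 1 (PowerSeries.X * (U 2 * a⁻¹))) N =
      ∏ i ∈ Finset.range N, PowerSeries.constantCoeff (U (i + 1) * a⁻¹) := by
  have := leadingMinor_interleaved_eq_prod N (fun i => U (i + 1) * a⁻¹) (fun i => c (i + 1))
    fun i hi => h.rel_mul_inv (by omega) (by omega)
  rwa [zero_add, h.one_mul_inv] at this

theorem normalized_eq_zero (h : IsStieltjesChain a b c k U) {N : ℕ} (hN : k + 2 ≤ N) :
    leadingMinor (interleavedMatrix 1 (PowerSeries.X * (U 2 * a⁻¹))) N = 0 := by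
  have := leadingMinor_interleaved_eq_zero k (fun i => U (i + 1) * a⁻¹) (fun i => c (i + 1)) N
    (fun i hi => h.rel_mul_inv (by omega) (by omega)) (by simp [h.last]) hN
  rwa [zero_add, h.one_mul_inv] at this

theorem normalized_ne_zero (h : IsStieltjesChain a b c k U) {i : ℕ} (h1 : 1 ≤ i)
    (hk : i ≤ k + 1) : PowerSeries.constantCoeff (U i * a⁻¹) ≠ 0 := by
  have h2 := congrArg PowerSeries.constantCoeff h.one_mul_inv
  rw [map_mul, map_one] at h2
  rw [map_mul]
  exact mul_ne_zero (h.ne_zero i h1 hk) (right_ne_zero_of_mul (h2 ▸ one_ne_zero))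

theorem coeff_normalized (h : IsStieltjesChain a b c k U) :
    (fun i => PowerSeries.coeff (i + 1) (PowerSeries.X * (U 2 * a⁻¹))) =
      fun i => PowerSeries.coeff (i + 1) (b * a⁻¹) :=
  coeff_succ_mul_inv (h.one ▸ h.ne_zero 1 le_rfl (by omega)) h.rel_zero

theorem hankelMinor_eq (h : IsStieltjesChain a b c k U) (j : ℕ) :
    hankelMinor (fun i => PowerSeries.coeff (i + 1) (b * a⁻¹)) j =
      leadingMinor (interleavedMatrix 1 (PowerSeries.X * (U 2 * a⁻¹))) (2 * j) := by
  rw [leadingMinor_interleaved_one_even, h.coeff_normalized]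

theorem shiftedHankelMinor_eq (h : IsStieltjesChain a b c k U) (j : ℕ) :
    shiftedHankelMinor (fun i => PowerSeries.coeff (i + 1) (b * a⁻¹)) j =
      (-1) ^ j * leadingMinor (interleavedMatrix 1 (PowerSeries.X * (U 2 * a⁻¹))) (2 * j + 1) := by
  rw [leadingMinor_interleaved_one_odd, h.coeff_normalized, ← mul_assoc, ← pow_add,
    Even.neg_one_pow ⟨_, rfl⟩, one_mul]

theorem normalized_minor_ne_zero (h : IsStieltjesChain a b c k U) {N : ℕ} (hN : N ≤ k + 1) :
    leadingMinor (interleavedMatrix 1 (PowerSeries.X * (U 2 * a⁻¹))) N ≠ 0 := by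
  rw [h.normalized_eq_prod hN, Finset.prod_ne_zero_iff]
  intro i hi
  rw [Finset.mem_range] at hi
  exact h.normalized_ne_zero (by omega) (by omega)

theorem coeff_eq_normalized (h : IsStieltjesChain a b c k U) {N : ℕ} (hN : N + 1 ≤ k) :
    c (N + 1) =
      leadingMinor (interleavedMatrix 1 (PowerSeries.X * (U 2 * a⁻¹))) (N + 1) ^ 2 /
        (leadingMinor (interleavedMatrix 1 (PowerSeries.X * (U 2 * a⁻¹))) N *
          leadingMinor (interleavedMatrix 1 (PowerSeries.X * (U 2 * a⁻¹))) (N + 2)) := by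
  rw [h.normalized_eq_prod (by omega), h.normalized_eq_prod (by omega),
    h.normalized_eq_prod (by omega),
    sq_prod_div_prod_mul_prod fun i hi => h.normalized_ne_zero (by omega) (by omega),
    h.coeff_eq (by omega) hN, map_mul, map_mul, mul_div_mul_right]
  have := h.normalized_ne_zero le_rfl (by omega : 1 ≤ k + 1)
  rw [map_mul] at this
  exact right_ne_zero_of_mul this

theorem coeff_eq_minor (h : IsStieltjesChain a b c k U) {N : ℕ} (hN : N + 1 ≤ k) :
    c (N + 1) =
      leadingMinor (interleavedMatrix a (PowerSeries.X * U 2)) (N + 1) ^ 2 /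
        (leadingMinor (interleavedMatrix a (PowerSeries.X * U 2)) N *
          leadingMinor (interleavedMatrix a (PowerSeries.X * U 2)) (N + 2)) := by
  rw [h.leadingMinor_eq_prod (by omega), h.leadingMinor_eq_prod (by omega),
    h.leadingMinor_eq_prod (by omega),
    sq_prod_div_prod_mul_prod fun i hi => h.ne_zero (i + 1) (by omega) (by omega),
    h.coeff_eq (by omega) hN]

theorem coeff_eq_minor' (h : IsStieltjesChain a b c k U)
    (hb : PowerSeries.constantCoeff b ≠ 0)
    (hc : c 0 = PowerSeries.constantCoeff b / PowerSeries.constantCoeff a) {N : ℕ} (hN : N ≤ k) :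
    c N =
      leadingMinor (interleavedMatrix b (PowerSeries.X * a)) (N + 1) ^ 2 /
        (leadingMinor (interleavedMatrix b (PowerSeries.X * a)) N *
          leadingMinor (interleavedMatrix b (PowerSeries.X * a)) (N + 2)) := by
  rw [h.leadingMinor_eq_prod' (by omega), h.leadingMinor_eq_prod' (by omega),
    h.leadingMinor_eq_prod' (by omega), sq_prod_div_prod_mul_prod]
  · rcases Nat.eq_zero_or_pos N with rfl | h0
    · rw [hc, h.zero, zero_add, h.one]
    · rw [h.coeff_eq h0 hN]
  · intro i hi
    rcases Nat.eq_zero_or_pos i with rfl | h0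
    · rwa [h.zero]
    · exact h.ne_zero i h0 (by omega)

theorem hankelFormulas (h : IsStieltjesChain a b c k U) {r : ℕ} (hr : 2 * r ≤ k + 1) :
    HankelFormulas (fun i => PowerSeries.coeff (i + 1) (b * a⁻¹)) r k c := by
  simp only [HankelFormulas, Finset.mem_Icc, h.hankelMinor_eq, h.shiftedHankelMinor_eq]
  constructor
  · rintro j ⟨h1, h2⟩
    obtain ⟨j, rfl⟩ : ∃ i, j = i + 1 := ⟨j - 1, by omega⟩
    rw [show 2 * (j + 1) = 2 * j + 1 + 1 by ring, h.coeff_eq_normalized (by omega),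
      Nat.add_sub_cancel]
    have : ((-1 : ℂ) ^ j) ^ 2 = 1 := by rw [← pow_mul, mul_comm, pow_mul]; simp
    have h3 : ∀ x y : ℂ, (-1) ^ j * x * ((-1) ^ (j + 1) * y) = -(x * y) := by
      intro x y
      linear_combination (-x * y) * this
    rw [h3, div_neg, neg_neg]
  · rintro j ⟨h1, h2⟩
    obtain ⟨j, rfl⟩ : ∃ i, j = i + 1 := ⟨j - 1, by omega⟩
    rw [show 2 * (j + 1) - 1 = 2 * j + 1 by omega, h.coeff_eq_normalized (by omega),
      Nat.add_sub_cancel, mul_pow, ← pow_mul, mul_comm j 2, pow_mul]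
    simp [mul_add]

end IsStieltjesChain

theorem hurwitzMatrix_eq_interleaved {n : ℕ} {p q : ℂ[X]} (hp : p.natDegree ≤ n)
    (hq : q.natDegree ≤ n) (h0 : q.coeff n = 0) :
    hurwitzMatrix n p q = interleavedMatrix (p.reflect n) (q.reflect n) := by
  ext i j
  rw [← mk_descCoeff hp, ← mk_descCoeff hq]
  simp only [hurwitzMatrix, interleavedMatrix, Matrix.of_apply, descCoeff_zero, h0, if_true,
    PowerSeries.coeff_X_pow_mul', shiftedEntry]
  split_ifs <;> simp

theorem hurwitzMatrix_eq_interleaved' {n : ℕ} {p q : ℂ[X]} (hp : p.natDegree ≤ n)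
    (hq : q.natDegree ≤ n) (h0 : q.coeff n ≠ 0) :
    hurwitzMatrix n p q =
      interleavedMatrix (q.reflect n) (PowerSeries.X * (p.reflect n : PowerSeries ℂ)) := by
  ext i j
  rw [← mk_descCoeff hp, ← mk_descCoeff hq]
  simp only [hurwitzMatrix, interleavedMatrix, Matrix.of_apply, descCoeff_zero, h0, if_false]
  split_ifs
  · simp [PowerSeries.coeff_X_pow_mul', shiftedEntry]
  · rw [← mul_assoc, ← pow_succ]
    simp [PowerSeries.coeff_X_pow_mul', shiftedEntry]

theorem laurentCoeff_eq {n : ℕ} {p q : ℂ[X]} (hp : p.natDegree ≤ n) (hq : q.natDegree ≤ n) :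
    laurentCoeff n p q = fun i => PowerSeries.coeff (i + 1)
      ((q.reflect n : PowerSeries ℂ) * (p.reflect n : PowerSeries ℂ)⁻¹) := by
  funext i
  rw [laurentCoeff, expansionAtInfinity_eq hp hq]

theorem coeff_eq_zero_iff_degree_lt {n : ℕ} {q : ℂ[X]} (hq : q.degree ≤ n) :
    q.coeff n = 0 ↔ q.degree < n := by
  constructor
  · intro h
    refine lt_of_le_of_ne hq fun h1 => ?_
    exact coeff_ne_zero_of_eq_degree h1 h
  · exact coeff_eq_zero_of_degree_lt

theorem IsStieltjesChain.hurwitzFormulas {n r k : ℕ} {p q : ℂ[X]} {c : ℕ → ℂ}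
    {U : ℕ → PowerSeries ℂ} (hp : p.natDegree ≤ n) (hq : q.degree ≤ n)
    (h : IsStieltjesChain (p.reflect n) (q.reflect n) c k U) (hr : 2 * r ≤ k + 1)
    (hc : q.degree = n → c 0 = q.coeff n / p.coeff n) :
    HurwitzFormulas n p q r k c := by
  have hq' : q.natDegree ≤ n := natDegree_le_of_degree_le hq
  constructor
  · intro hlt
    have h0 := coeff_eq_zero_of_degree_lt hlt
    have hb := h.rel_zero
    rw [constantCoeff_reflect n q, h0] at hb
    simp only [zero_div, map_zero, zero_mul, zero_add] at hb
    have he : ∀ N, eta n p q N =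
        leadingMinor (interleavedMatrix (p.reflect n) (PowerSeries.X * U 2)) N := by
      intro N
      rw [← hb, ← hurwitzMatrix_eq_interleaved hp hq' h0]
      rfl
    simp only [Finset.mem_Icc, he]
    constructor
    · rintro j ⟨h1, h2⟩
      obtain ⟨j, rfl⟩ : ∃ i, j = i + 1 := ⟨j - 1, by omega⟩
      exact h.coeff_eq_minor (N := 2 * j) (by omega)
    · rintro j ⟨h1, h2⟩
      obtain ⟨j, rfl⟩ : ∃ i, j = i + 1 := ⟨j - 1, by omega⟩
      exact h.coeff_eq_minor (N := 2 * j + 1) (by omega)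
  · intro heq
    have h0 := coeff_ne_zero_of_eq_degree heq
    have he : ∀ N, eta n p q N = leadingMinor (interleavedMatrix (q.reflect n)
        (PowerSeries.X * (p.reflect n : PowerSeries ℂ))) N := by
      intro N
      rw [← hurwitzMatrix_eq_interleaved' hp hq' h0]
      rfl
    have hc' := hc heq
    rw [← constantCoeff_reflect n p, ← constantCoeff_reflect n q] at hc'
    rw [← constantCoeff_reflect] at h0
    simp only [Finset.mem_Icc, he]
    constructor
    · rintro j ⟨h1, h2⟩
      obtain ⟨j, rfl⟩ : ∃ i, j = i + 1 := ⟨j - 1, by omega⟩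
      exact h.coeff_eq_minor' h0 hc' (N := 2 * j + 1) (by omega)
    · rintro j ⟨h1, h2⟩
      exact h.coeff_eq_minor' h0 hc' (N := 2 * j) (by omega)

/-! ### Reduced fractions, and the chain obtained from the Hankel condition. -/

theorem exists_reduced {n r : ℕ} {p q : ℂ[X]} (hp : p.degree = n) (hq : q.degree ≤ n)
    (hr : poleCount (ratioFun p q) = r) :
    ∃ g p' q' : ℂ[X], p = g * p' ∧ q = g * q' ∧ g ≠ 0 ∧ p' ≠ 0 ∧ IsCoprime p' q' ∧
      p'.natDegree = r ∧ q'.natDegree ≤ r ∧ g.natDegree + r = n ∧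
      laurentCoeff n p q = laurentCoeff r p' q' ∧ ratioFun p q = ratioFun p' q' ∧
      (HasPoleAt (ratioFun p q) 0 ↔ p'.IsRoot 0) := by
  have hp0 : p ≠ 0 := by
    rintro rfl
    simp at hp
  have hpn : p.natDegree = n := natDegree_eq_of_degree_eq_some hp
  have hqn : q.natDegree ≤ n := natDegree_le_of_degree_le hq
  obtain ⟨g, hg⟩ := RatFunc.denom_div_dvd q p
  set R := ratioFun p q with hR
  have hg' : p = g * R.denom := by
    rw [mul_comm]
    exact hg
  have hd0 : R.denom ≠ 0 := R.denom_ne_zero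
  have hg0 : g ≠ 0 := left_ne_zero_of_mul (hg' ▸ hp0)
  have hR' : R = ratioFun R.denom R.num := (RatFunc.num_div_denom R).symm
  have hqg : q = g * R.num := by
    have h1 : algebraMap ℂ[X] (RatFunc ℂ) q / algebraMap ℂ[X] (RatFunc ℂ) p =
        algebraMap ℂ[X] (RatFunc ℂ) R.num / algebraMap ℂ[X] (RatFunc ℂ) R.denom := hR'
    rw [div_eq_div_iff (RatFunc.algebraMap_ne_zero hp0) (RatFunc.algebraMap_ne_zero hd0),
      ← map_mul, ← map_mul] at h1
    have h2 := RatFunc.algebraMap_injective ℂ h1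
    apply mul_right_cancel₀ hd0
    rw [h2]
    conv_lhs => rw [hg']
    ring
  have hrd : R.denom.natDegree = r := by
    rw [← hr, poleCount]
    exact (IsAlgClosed.card_roots_eq_natDegree).symm
  have hn : g.natDegree + r = n := by
    rw [← hpn, hg', natDegree_mul hg0 hd0, hrd]
  have hqr : R.num.natDegree ≤ r := by
    by_cases h0 : R.num = 0
    · simp [h0]
    · rw [hqg, natDegree_mul hg0 h0] at hqn
      omega
  refine ⟨g, R.denom, R.num, hg', hqg, hg0, hd0, (RatFunc.isCoprime_num_denom R).symm, hrd, hqr, hn,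
    ?_, hR', Iff.rfl⟩
  funext i
  rw [laurentCoeff, laurentCoeff]
  conv_lhs => rw [hg', hqg, ← hn]
  rw [expansionAtInfinity_mul_left rfl hg0 hrd.le hqr]

theorem IsStieltjesChain.mul_left {a b : PowerSeries ℂ} {c : ℕ → ℂ} {k : ℕ}
    {U : ℕ → PowerSeries ℂ} (h : IsStieltjesChain a b c k U) {G : PowerSeries ℂ}
    (hG : PowerSeries.constantCoeff G ≠ 0) :
    IsStieltjesChain (G * a) (G * b) c k (fun i => G * U i) where
  zero := by rw [h.zero]
  one := by rw [h.one]
  rel_zero := by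
    rw [map_mul, map_mul, mul_div_mul_left _ _ hG]
    linear_combination G * h.rel_zero
  rel i h1 hk := by linear_combination G * h.rel i h1 hk
  last := by rw [h.last, mul_zero]
  ne_zero i h1 hk := by
    rw [map_mul]
    exact mul_ne_zero hG (h.ne_zero i h1 hk)

/-- The sequence of remainders of the division of power series with linear quotients. -/
noncomputable def remSeq (U V : ℂ[X]) : ℕ → ℂ[X]
  | 0 => U
  | 1 => V
  | i + 2 => divX (remSeq U V i -
      C ((remSeq U V i).coeff 0 / (remSeq U V (i + 1)).coeff 0) * remSeq U V (i + 1))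

theorem remSeq_rel {U V : ℂ[X]} {i : ℕ} (h : (remSeq U V (i + 1)).coeff 0 ≠ 0) :
    remSeq U V i = C ((remSeq U V i).coeff 0 / (remSeq U V (i + 1)).coeff 0) *
      remSeq U V (i + 1) + X * remSeq U V (i + 2) := by
  have h1 := divX_mul_X_add (remSeq U V i -
      C ((remSeq U V i).coeff 0 / (remSeq U V (i + 1)).coeff 0) * remSeq U V (i + 1))
  rw [coeff_sub, coeff_C_mul, div_mul_cancel₀ _ h, sub_self, map_zero, add_zero] at h1
  rw [remSeq]
  linear_combination -h1

/-- Two steps of the division lower the degree bound by one. The bound holds even when a divisor has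
zero constant term, and it forces termination. -/
theorem coeff_remSeq_eq_zero {U V : ℂ[X]} {r : ℕ} (hU : U.natDegree ≤ r) (hV : V.natDegree ≤ r) :
    ∀ i m, 2 * r + 1 < i + 2 * m → (remSeq U V i).coeff m = 0
  | 0, m, h => coeff_eq_zero_of_natDegree_lt (hU.trans_lt (by omega))
  | 1, m, h => coeff_eq_zero_of_natDegree_lt (hV.trans_lt (by omega))
  | i + 2, m, h => by
    rw [remSeq, coeff_divX, coeff_sub, coeff_C_mul,
      coeff_remSeq_eq_zero hU hV i (m + 1) (by omega),
      coeff_remSeq_eq_zero hU hV (i + 1) (m + 1) (by omega), mul_zero, sub_zero]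

theorem exists_stieltjesChain {r : ℕ} {p q : ℂ[X]} (hp : p.natDegree = r) (hp0 : p ≠ 0)
    (hq : q.natDegree ≤ r) (hc : IsCoprime p q)
    (hD : ∀ j ∈ Finset.Icc 1 r, hankelMinor (laurentCoeff r p q) j ≠ 0)
    (hD' : ∀ j ∈ Finset.Icc 1 (r - 1), shiftedHankelMinor (laurentCoeff r p q) j ≠ 0)
    {k : ℕ} (hk : (p.IsRoot 0 ∧ k = 2 * r - 1) ∨ (¬ p.IsRoot 0 ∧ k = 2 * r)) :
    ∃ (c : ℕ → ℂ) (U : ℕ → ℂ[X]), c 0 = q.coeff r / p.coeff r ∧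
      IsStieltjesChain (p.reflect r) (q.reflect r) c k (fun i => (U i : PowerSeries ℂ)) ∧
      (∀ i m, 2 * r + 1 < i + 2 * m → (U i).coeff m = 0) := by
  set a := p.reflect r with ha
  set b := q.reflect r with hb
  have ha0 : PowerSeries.constantCoeff (a : PowerSeries ℂ) ≠ 0 := by
    rw [ha, constantCoeff_reflect, ← hp]
    exact leadingCoeff_ne_zero.2 hp0
  set U := remSeq b a with hU
  set c : ℕ → ℂ := fun i => (U i).coeff 0 / (U (i + 1)).coeff 0 with hcdef
  have hcc : ∀ f : ℂ[X], PowerSeries.constantCoeff (f : PowerSeries ℂ) = f.coeff 0 := fun f => by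
    rw [← PowerSeries.coeff_zero_eq_constantCoeff_apply, Polynomial.coeff_coe]
  have hrel : ∀ i, (U (i + 1)).coeff 0 ≠ 0 → (U i : PowerSeries ℂ) =
      PowerSeries.C (c i) * (U (i + 1) : PowerSeries ℂ) +
        PowerSeries.X * (U (i + 2) : PowerSeries ℂ) := by
    intro i hi
    have := congrArg (fun f : ℂ[X] => (f : PowerSeries ℂ)) (remSeq_rel hi)
    push_cast at this
    exact this
  have hU0 : (U 0 : PowerSeries ℂ) = b := rfl
  have hU1 : (U 1 : PowerSeries ℂ) = a := rfl
  have hr0 := hrel 0 (by rwa [← hcc])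
  have hlc := coeff_succ_mul_inv ha0 hr0
  have hsupp : ∀ i m, 2 * r + 1 < i + 2 * m → (U i).coeff m = 0 :=
    coeff_remSeq_eq_zero (natDegree_reflect_le_of_le hq) (natDegree_reflect_le_of_le hp.le)
  set L : ℕ → ℂ := fun N => leadingMinor (interleavedMatrix 1
    (PowerSeries.X * ((U 2 : PowerSeries ℂ) * (a : PowerSeries ℂ)⁻¹))) N with hL
  have hprod : ∀ N, (∀ i, 1 ≤ i → i < N → (U i).coeff 0 ≠ 0) →
      L N = ∏ i ∈ Finset.range N, PowerSeries.constantCoeff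
        ((U (i + 1) : PowerSeries ℂ) * (a : PowerSeries ℂ)⁻¹) := by
    intro N hN
    have := leadingMinor_interleaved_eq_prod N
      (fun i => (U (i + 1) : PowerSeries ℂ) * (a : PowerSeries ℂ)⁻¹) (fun i => c (i + 1))
      fun i hi => by
        rw [hrel (i + 1) (hN _ (by omega) (by omega))]
        ring
    rwa [zero_add, hU1, PowerSeries.mul_inv_cancel _ ha0] at this
  have heven : ∀ j, L (2 * j) = hankelMinor (laurentCoeff r p q) j := by
    intro j
    rw [laurentCoeff_eq hp.le hq, hL]
    simp only
    rw [leadingMinor_interleaved_one_even, hlc]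
    rfl
  have hodd : ∀ j, L (2 * j + 1) = (-1) ^ j * shiftedHankelMinor (laurentCoeff r p q) j := by
    intro j
    rw [laurentCoeff_eq hp.le hq, hL]
    simp only
    rw [leadingMinor_interleaved_one_odd, hlc]
    rfl
  have hsgn : ∀ j : ℕ, ((-1 : ℂ)) ^ j ≠ 0 := fun j => pow_ne_zero _ (by norm_num)
  have hLne : ∀ N, 1 ≤ N → N ≤ 2 * r → L N ≠ 0 := by
    intro N h1 hN
    rcases Nat.even_or_odd' N with ⟨j, rfl | rfl⟩
    · rw [heven]
      exact hD j (Finset.mem_Icc.2 ⟨by omega, by omega⟩)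
    · rw [hodd]
      refine mul_ne_zero (hsgn j) ?_
      rcases Nat.eq_zero_or_pos j with rfl | hj
      · simp [shiftedHankelMinor]
      · exact hD' j (Finset.mem_Icc.2 ⟨hj, by omega⟩)
  -- The product formula for L N needs nonzero constant terms only before the last factor, so L N ≠
  -- 0 gives the next one by induction.
  have hstep : ∀ N, 1 ≤ N → (∀ i, 1 ≤ i → i < N → (U i).coeff 0 ≠ 0) → L N ≠ 0 →
      (U N).coeff 0 ≠ 0 := by
    intro N h1 hN hne
    obtain ⟨N, rfl⟩ : ∃ i, N = i + 1 := ⟨N - 1, by omega⟩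
    rw [hprod _ hN, Finset.prod_range_succ, map_mul, hcc] at hne
    exact left_ne_zero_of_mul (right_ne_zero_of_mul hne)
  have hne : ∀ i, 1 ≤ i → i ≤ 2 * r → (U i).coeff 0 ≠ 0 := by
    intro i
    induction i using Nat.strong_induction_on with
    | _ i ih =>
      intro h1 hi
      exact hstep i h1 (fun j h2 h3 => ih j h3 h2 (by omega)) (hLne i h1 hi)
  have hroot : L (2 * r + 1) = 0 ↔ p.IsRoot 0 := by
    rw [hodd, mul_eq_zero, or_iff_right (hsgn r), shiftedHankelMinor_eq_zero_iff hp hp0 hq hc le_rfl]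
    simp
  have hk1 : ∀ i, 1 ≤ i → i ≤ k + 1 → (U i).coeff 0 ≠ 0 := by
    intro i h1 hi
    by_cases h2 : i ≤ 2 * r
    · exact hne i h1 h2
    · rcases hk with ⟨h3, rfl⟩ | ⟨h3, rfl⟩
      -- For r = 0 the truncated 2r - 1 is 0, but then p is a nonzero constant and has no root at 0.
      · by_cases hr : r = 0
        · have h4 : p.degree ≠ 0 := by
            intro h5
            rw [eq_C_of_degree_eq_zero h5, IsRoot, eval_C] at h3
            rw [eq_C_of_degree_eq_zero h5, h3] at hp0
            simp at hp0
          rw [degree_eq_natDegree hp0, hp, hr] at h4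
          simp at h4
        · omega
      · obtain rfl : i = 2 * r + 1 := by omega
        exact hstep _ h1 (fun j h4 h5 => hne j h4 (by omega)) (mt hroot.1 h3)
  refine ⟨c, U, ?_, ?_, hsupp⟩
  · rw [← constantCoeff_reflect r p, ← constantCoeff_reflect r q, hcc, hcc]
    rfl
  refine ⟨rfl, rfl, ?_, ?_, ?_, ?_⟩
  · rw [hcc, hcc]
    exact hr0
  · intro i h1 hi
    exact hrel i (hk1 _ (by omega) (by omega))
  · suffices h : U (k + 2) = 0 by simp [h]
    ext m
    rw [coeff_zero]
    rcases hk with ⟨h3, rfl⟩ | ⟨h3, rfl⟩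
    · rcases Nat.eq_zero_or_pos m with rfl | hm
      · by_cases hr : r = 0
        · exact hsupp _ _ (by omega)
        -- With a pole at 0 the minor of order 2r + 1 vanishes while its first 2r factors do not. So
        -- the constant term of U at index 2r + 1 is zero, and the degree bound handles its other
        -- coefficients.
        · rw [show 2 * r - 1 + 2 = 2 * r + 1 by omega]
          have := hroot.2 h3
          by_contra h4
          rw [hprod _ (fun i h1 h2 => hne i h1 (by omega)), Finset.prod_eq_zero_iff] at this
          obtain ⟨i, hi, h5⟩ := this
          rw [Finset.mem_range] at hi
          rw [map_mul, mul_eq_zero, hcc, PowerSeries.constantCoeff_inv, inv_eq_zero,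
            or_iff_left ha0] at h5
          by_cases h6 : i + 1 ≤ 2 * r
          · exact hne _ (by omega) h6 h5
          · rw [show i + 1 = 2 * r + 1 by omega] at h5
            exact h4 h5
      · exact hsupp _ _ (by omega)
    · exact hsupp _ _ (by omega)
  · intro i h1 hi
    rw [hcc]
    exact hk1 i h1 hi

/-! ### Chains and Stieltjes continued fractions. -/

theorem exists_continuants (K : ℕ) : ∀ (c : ℕ → ℂ) (G : ℂ[X]),
    ∃ V : ℕ → ℂ[X], V K = G ∧ V (K + 1) = 0 ∧
      ∀ i < K, V i = C (c i) * V (i + 1) + X * V (i + 2) := by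
  induction K with
  | zero => exact fun c G => ⟨fun i => if i = 0 then G else 0, by simp⟩
  | succ K ih =>
    intro c G
    obtain ⟨V, h1, h2, h3⟩ := ih (fun i => c (i + 1)) G
    refine ⟨fun i => Nat.casesOn i (C (c 0) * V 0 + X * V 1) V, h1, h2, ?_⟩
    rintro (_ | i) hi
    · rfl
    · exact h3 i (by omega)

theorem coeff_zero_continuant_ne_zero {K : ℕ} {c : ℕ → ℂ} {V : ℕ → ℂ[X]} {l : ℕ}
    (hK : (V K).coeff 0 ≠ 0) (hc : ∀ i, l ≤ i → i < K → c i ≠ 0)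
    (h : ∀ i, l ≤ i → i < K → V i = C (c i) * V (i + 1) + X * V (i + 2)) :
    ∀ i, l ≤ i → i ≤ K → (V i).coeff 0 ≠ 0 := by
  have : ∀ d i, i + d = K → l ≤ i → (V i).coeff 0 ≠ 0 := by
    intro d
    induction d with
    | zero =>
      rintro i rfl _
      exact hK
    | succ d ih =>
      intro i hi hl
      rw [h i hl (by omega)]
      simpa using ⟨hc i hl (by omega), ih (i + 1) (by omega) (by omega)⟩
  exact fun i h1 h2 => this (K - i) i (by omega) h1

/-- The substitution of `1/z` into a polynomial. -/
noncomputable def evalInvX : ℂ[X] →ₐ[ℂ] RatFunc ℂ := aeval (RatFunc.X : RatFunc ℂ)⁻¹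

theorem evalInvX_X : evalInvX X = (RatFunc.X : RatFunc ℂ)⁻¹ := aeval_X _

theorem evalInvX_C (x : ℂ) : evalInvX (C x) = RatFunc.C x := aeval_C _ x

theorem X_pow_mul_evalInvX_reflect {n : ℕ} {f : ℂ[X]} (h : f.natDegree ≤ n) :
    RatFunc.X ^ n * evalInvX (f.reflect n) = algebraMap ℂ[X] (RatFunc ℂ) f := by
  let _ := invertibleOfNonzero (RatFunc.X_ne_zero (K := ℂ))
  have := eval₂_reflect_mul_pow (algebraMap ℂ (RatFunc ℂ)) RatFunc.X n f h
  rw [invOf_eq_inv] at this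
  rw [mul_comm]
  refine this.trans ?_
  rw [← aeval_def, RatFunc.aeval_X_left_eq_algebraMap]

theorem evalInvX_injective : Function.Injective evalInvX := by
  rw [injective_iff_map_eq_zero]
  intro f hf
  have := X_pow_mul_evalInvX_reflect (natDegree_reflect_le_of_le (le_refl f.natDegree))
  rw [reflect_reflect, hf, mul_zero, eq_comm,
    map_eq_zero_iff _ (RatFunc.algebraMap_injective ℂ), reflect_eq_zero_iff] at this
  exact this

theorem ratioFun_eq_evalInvX {n : ℕ} {p q : ℂ[X]} (hp : p.natDegree ≤ n) (hq : q.natDegree ≤ n) :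
    ratioFun p q = evalInvX (q.reflect n) / evalInvX (p.reflect n) := by
  rw [ratioFun, ← X_pow_mul_evalInvX_reflect hp, ← X_pow_mul_evalInvX_reflect hq,
    mul_div_mul_left _ _ (pow_ne_zero _ RatFunc.X_ne_zero)]

theorem stieltjesFraction_eq_div {c : ℕ → ℂ} {k : ℕ} {U : ℕ → ℂ[X]}
    (hrel : ∀ i, 1 ≤ i → i ≤ k → U i = C (c i) * U (i + 1) + X * U (i + 2))
    (hlast : U (k + 2) = 0) (hne : ∀ i, 1 ≤ i → i ≤ k + 1 → U i ≠ 0) :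
    stieltjesFraction c 1 k = RatFunc.X⁻¹ * evalInvX (U 2) / evalInvX (U 1) := by
  have hX : (RatFunc.X : RatFunc ℂ) ≠ 0 := RatFunc.X_ne_zero
  -- This scaling absorbs the factor 1/z of the recurrence: it becomes yᵢ = tᵢyᵢ₊₁ + yᵢ₊₂, with tᵢ =
  -- cᵢz for odd i and cᵢ for even i.
  set y : ℕ → RatFunc ℂ := fun i => (RatFunc.X⁻¹) ^ (i / 2) * evalInvX (U i) with hy
  have hyne : ∀ i, 1 ≤ i → i ≤ k + 1 → y i ≠ 0 := by
    intro i h1 hi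
    refine mul_ne_zero (pow_ne_zero _ (inv_ne_zero hX)) ?_
    rw [Ne, map_eq_zero_iff _ evalInvX_injective]
    exact hne i h1 hi
  have hyrel : ∀ i, 1 ≤ i → i ≤ k → y i = stieltjesQuotient c i * y (i + 1) + y (i + 2) := by
    intro i h1 hi
    simp only [hy]
    rw [hrel i h1 hi, map_add, map_mul, map_mul, evalInvX_X, evalInvX_C, stieltjesQuotient]
    rcases Nat.even_or_odd' i with ⟨l, rfl | rfl⟩
    · rw [if_neg (by simp), show (2 * l + 1) / 2 = l by omega,
        show (2 * l + 2) / 2 = l + 1 by omega, show 2 * l / 2 = l by omega]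
      ring
    · rw [if_pos (by simp), show (2 * l + 1 + 1) / 2 = l + 1 by omega,
        show (2 * l + 1 + 2) / 2 = l + 1 by omega, show (2 * l + 1) / 2 = l by omega]
      rw [pow_succ]
      field_simp
  have key : ∀ m j, 1 ≤ j → j + m = k + 1 → stieltjesFraction c j m = y (j + 1) / y j := by
    intro m
    induction m with
    | zero =>
      intro j _ hjk
      obtain rfl : j = k + 1 := by omega
      simp [stieltjesFraction, hy, hlast]
    | succ m ih =>
      intro j hj hjk
      rw [stieltjesFraction, ih (j + 1) (by omega) (by omega), hyrel j hj (by omega)]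
      have h1 := hyne (j + 1) (by omega) (by omega)
      have h2 := hyne j hj (by omega)
      rw [hyrel j hj (by omega)] at h2
      have h3 : stieltjesQuotient c j + y (j + 2) / y (j + 1) =
          (stieltjesQuotient c j * y (j + 1) + y (j + 2)) / y (j + 1) := by
        field_simp
      rw [h3, one_div_div]
  rw [key k 1 le_rfl (by omega)]
  simp [hy]

theorem coe_constantCoeff (f : ℂ[X]) :
    PowerSeries.constantCoeff (f : PowerSeries ℂ) = f.coeff 0 := by
  rw [← PowerSeries.coeff_zero_eq_constantCoeff_apply, Polynomial.coeff_coe]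

theorem ratioFun_sub_eq_stieltjesFraction {n k : ℕ} {p q : ℂ[X]} {c : ℕ → ℂ} {U : ℕ → ℂ[X]}
    (hp : p.natDegree ≤ n) (hq : q.natDegree ≤ n) (hc : c 0 = q.coeff n / p.coeff n)
    (h : IsStieltjesChain (p.reflect n) (q.reflect n) c k (fun i => (U i : PowerSeries ℂ))) :
    ratioFun p q - RatFunc.C (c 0) = stieltjesFraction c 1 k := by
  have hne : ∀ i, 1 ≤ i → i ≤ k + 1 → U i ≠ 0 := by
    intro i h1 hi h0
    have := h.ne_zero i h1 hi
    simp [h0] at this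
  have h1 : U 1 = p.reflect n := Polynomial.coe_injective ℂ h.one
  have hzero : q.reflect n = C (c 0) * p.reflect n + X * U 2 := by
    apply Polynomial.coe_injective ℂ
    have := h.rel_zero
    rw [constantCoeff_reflect, constantCoeff_reflect, ← hc] at this
    push_cast
    exact this
  rw [stieltjesFraction_eq_div (U := U) (c := c) (k := k) ?_ ?_ hne,
    ratioFun_eq_evalInvX hp hq, hzero, h1, map_add, map_mul, map_mul, evalInvX_X, evalInvX_C]
  · have : evalInvX (p.reflect n) ≠ 0 := by
      rw [Ne, map_eq_zero_iff _ evalInvX_injective, ← h1]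
      exact hne 1 le_rfl (by omega)
    field_simp
    ring
  · intro i hi hik
    apply Polynomial.coe_injective ℂ
    push_cast
    exact h.rel i hi hik
  · apply Polynomial.coe_injective ℂ
    rw [h.last, Polynomial.coe_zero]

/-- The recurrence is run backwards from 1, 0. Its constant terms are products of the nonzero cᵢ.
Rescaling by a/V₁, which is legitimate for power series since V₁(0) ≠ 0, makes the chain start at a
without comparing gcds. -/
theorem exists_stieltjesChain_of_ratioFun_sub_eq {n k : ℕ} {p q : ℂ[X]} {c : ℕ → ℂ}
    (hp : p.natDegree ≤ n) (hpn : p.coeff n ≠ 0) (hq : q.natDegree ≤ n)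
    (hc0 : c 0 = q.coeff n / p.coeff n)
    (hc : ∀ j, 1 ≤ j → j ≤ k → c j ≠ 0)
    (h : ratioFun p q - RatFunc.C (c 0) = stieltjesFraction c 1 k) :
    ∃ U, IsStieltjesChain (p.reflect n) (q.reflect n) c k U := by
  obtain ⟨V, h1, h2, h3⟩ := exists_continuants (k + 1) c 1
  have hV := coeff_zero_continuant_ne_zero (K := k + 1) (c := c) (V := V) (l := 1)
    (by simp [h1]) (fun i hi hik => hc i hi (by omega)) (fun i _ hik => h3 i hik)
  have hne : ∀ i, 1 ≤ i → i ≤ k + 1 → V i ≠ 0 := by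
    intro i h4 hi h0
    have := hV i h4 hi
    simp [h0] at this
  have ha : PowerSeries.constantCoeff (p.reflect n : PowerSeries ℂ) ≠ 0 := by
    rwa [constantCoeff_reflect]
  have hb : q.reflect n * V 1 = C (c 0) * p.reflect n * V 1 + X * (p.reflect n * V 2) := by
    rw [stieltjesFraction_eq_div (fun i _ hik => h3 i (by omega)) h2 hne,
      ratioFun_eq_evalInvX hp hq] at h
    have e1 : evalInvX (p.reflect n) ≠ 0 := by
      rw [Ne, map_eq_zero_iff _ evalInvX_injective]
      intro h0
      simp [h0] at ha
    have e2 : evalInvX (V 1) ≠ 0 := by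
      rw [Ne, map_eq_zero_iff _ evalInvX_injective]
      exact hne 1 le_rfl (by omega)
    apply evalInvX_injective
    simp only [map_add, map_mul, evalInvX_X, evalInvX_C]
    rw [sub_eq_iff_eq_add, div_eq_iff e1] at h
    rw [h]
    field_simp
    ring
  have hV1 : PowerSeries.constantCoeff (V 1 : PowerSeries ℂ) ≠ 0 := by
    rw [coe_constantCoeff]
    exact hV 1 le_rfl (by omega)
  have hinv := PowerSeries.mul_inv_cancel (V 1 : PowerSeries ℂ) hV1
  refine ⟨fun i => if i = 0 then (q.reflect n : PowerSeries ℂ) else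
    (p.reflect n : PowerSeries ℂ) * V i * (V 1 : PowerSeries ℂ)⁻¹, ?_⟩
  refine ⟨rfl, ?_, ?_, ?_, ?_, ?_⟩
  · simp [mul_assoc, hinv]
  · rw [constantCoeff_reflect, constantCoeff_reflect, ← hc0]
    have hb' := congrArg (fun f : ℂ[X] => (f : PowerSeries ℂ)) hb
    push_cast at hb'
    simp only [OfNat.ofNat_ne_zero, if_false]
    linear_combination (V 1 : PowerSeries ℂ)⁻¹ * hb' +
      (PowerSeries.C (c 0) * (p.reflect n : PowerSeries ℂ) - (q.reflect n : PowerSeries ℂ)) * hinv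
  · intro i hi hik
    have := congrArg (fun f : ℂ[X] => (f : PowerSeries ℂ)) (h3 i (by omega))
    push_cast at this
    simp only [show i ≠ 0 by omega, Nat.succ_ne_zero, if_false]
    rw [this]
    ring
  · simp [h2]
  · intro i hi hik
    simp only [show i ≠ 0 by omega, if_false, map_mul, PowerSeries.constantCoeff_inv]
    refine mul_ne_zero (mul_ne_zero ha ?_) (inv_ne_zero hV1)
    rw [coe_constantCoeff]
    exact hV i hi hik

/-! ### Factorization of the matrix of Hurwitz type. -/

theorem interleavedMatrix_even (U V : PowerSeries ℂ) (i j : ℕ) :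
    interleavedMatrix U V (2 * i) j = PowerSeries.coeff j (PowerSeries.X ^ i * U) := by
  simp [interleavedMatrix]

theorem interleavedMatrix_odd (U V : PowerSeries ℂ) (i j : ℕ) :
    interleavedMatrix U V (2 * i + 1) j = PowerSeries.coeff j (PowerSeries.X ^ i * V) := by
  have : (2 * i + 1) / 2 = i := by omega
  simp [interleavedMatrix, this]

theorem interleavedMatrix_inj {U V U' V' : PowerSeries ℂ}
    (h : interleavedMatrix U V = interleavedMatrix U' V') : U = U' ∧ V = V' := by
  constructor
  · ext j
    have := congrFun (congrFun h (2 * 0)) j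
    simpa only [interleavedMatrix_even, pow_zero, one_mul] using this
  · ext j
    have := congrFun (congrFun h (2 * 0 + 1)) j
    simpa only [interleavedMatrix_odd, pow_zero, one_mul] using this

/-- For U = Uᵢ₊₁ and V = XUᵢ₊₂ this is one backward step of the recurrence. -/
theorem infMul_matrixJ_interleavedMatrix (c : ℂ) (U V : PowerSeries ℂ) :
    infMul (matrixJ c) (interleavedMatrix U V) =
      interleavedMatrix (PowerSeries.C c * U + V) (PowerSeries.X * U) := by
  ext i j
  simp only [infMul, Matrix.of_apply]
  rcases Nat.even_or_odd' i with ⟨l, rfl | rfl⟩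
  · rw [finsum_eq_sum_of_support_subset (s := {2 * l, 2 * l + 1}), Finset.sum_pair (by omega),
      interleavedMatrix_even, interleavedMatrix_even, interleavedMatrix_odd]
    · simp only [matrixJ, Matrix.of_apply, even_two, Even.mul_right, if_true]
      rw [if_neg (by omega), one_mul, mul_add, map_add, mul_left_comm, PowerSeries.coeff_C_mul]
    · intro m hm
      simp only [Function.mem_support, matrixJ, Matrix.of_apply, even_two, Even.mul_right,
        if_true] at hm
      simp only [Finset.coe_insert, Finset.coe_singleton, Set.mem_insert_iff,
        Set.mem_singleton_iff]
      by_contra! h0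
      simp [h0.1, h0.2] at hm
  · have hodd : ¬ Even (2 * l + 1) := by simp
    rw [finsum_eq_single _ (2 * (l + 1)), interleavedMatrix_even, interleavedMatrix_odd]
    · simp only [matrixJ, Matrix.of_apply, hodd, if_false]
      rw [if_pos (by ring), one_mul, pow_succ, mul_assoc]
    · intro m hm
      simp only [matrixJ, Matrix.of_apply, hodd, if_false]
      rw [if_neg (by omega), zero_mul]

theorem infMul_hurwitzMatrix_zero_one (g : ℂ[X]) :
    infMul (hurwitzMatrix 0 0 1) (toeplitzMatrix g) =
      interleavedMatrix (g.reflect g.natDegree) 0 := by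
  have h1 : hurwitzMatrix 0 0 1 = interleavedMatrix 1 0 := by
    rw [hurwitzMatrix_eq_interleaved' (by simp) (by simp) (by simp)]
    simp
  rw [h1]
  ext i j
  simp only [infMul, Matrix.of_apply]
  rcases Nat.even_or_odd' i with ⟨l, rfl | rfl⟩
  · rw [finsum_eq_single _ l, interleavedMatrix_even, interleavedMatrix_even, ← mk_descCoeff le_rfl]
    · simp [toeplitzMatrix, PowerSeries.coeff_X_pow, PowerSeries.coeff_X_pow_mul', shiftedEntry]
    · intro m hm
      rw [interleavedMatrix_even]
      simp [PowerSeries.coeff_X_pow, hm]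
  · simp [interleavedMatrix_odd]

theorem prodJ_interleavedMatrix {c : ℕ → ℂ} {U : ℕ → PowerSeries ℂ} (m : ℕ) : ∀ j,
    (∀ i, j ≤ i → i < j + m →
      U i = PowerSeries.C (c i) * U (i + 1) + PowerSeries.X * U (i + 2)) →
    prodJ c (interleavedMatrix (U (j + m)) (PowerSeries.X * U (j + m + 1))) j m =
      interleavedMatrix (U j) (PowerSeries.X * U (j + 1)) := by
  induction m with
  | zero => exact fun j _ => rfl
  | succ m ih =>
    intro j h
    have := ih (j + 1) fun i h1 h2 => h i (by omega) (by omega)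
    rw [show j + 1 + m = j + (m + 1) by ring] at this
    rw [prodJ, this, infMul_matrixJ_interleavedMatrix, ← h j le_rfl (by omega)]

theorem IsStieltjesChain.isHurwitzFactorization {n r : ℕ} {p q : ℂ[X]} {c : ℕ → ℂ}
    {U : ℕ → PowerSeries ℂ} {g : ℂ[X]} (hp : p.natDegree ≤ n) (hq : q.degree ≤ n)
    (hc : c 0 = q.coeff n / p.coeff n)
    (h : IsStieltjesChain (p.reflect n) (q.reflect n) c (fractionLength (ratioFun p q) r) U)
    (hg : IsGreatestCommonDivisor g p q)
    (hgU : U (fractionLength (ratioFun p q) r + 1) = (g.reflect g.natDegree : PowerSeries ℂ)) :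
    IsHurwitzFactorization n r p q c g := by
  set k := fractionLength (ratioFun p q) r with hk
  have hq' : q.natDegree ≤ n := natDegree_le_of_degree_le hq
  have hrel : ∀ i ≤ k, U i = PowerSeries.C (c i) * U (i + 1) + PowerSeries.X * U (i + 2) := by
    intro i hi
    rcases Nat.eq_zero_or_pos i with rfl | h0
    · have := h.rel_zero
      rw [constantCoeff_reflect, constantCoeff_reflect, ← hc] at this
      rw [h.zero, zero_add, h.one]
      exact this
    · exact h.rel i h0 hi
  have hT : infMul (hurwitzMatrix 0 0 1) (toeplitzMatrix g) =
      interleavedMatrix (U (k + 1)) (PowerSeries.X * U (k + 2)) := by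
    rw [infMul_hurwitzMatrix_zero_one, hgU, h.last, mul_zero]
  refine ⟨hg, fun hlt => ?_, fun heq => ?_⟩
  · rw [hT, ← hk]
    have h0 := coeff_eq_zero_of_degree_lt hlt
    have := prodJ_interleavedMatrix k 1 fun i _ hi => hrel i (by omega)
    rw [add_comm 1 k] at this
    rw [this, hurwitzMatrix_eq_interleaved hp hq' h0, h.one]
    congr 1
    have hb := h.rel_zero
    rw [constantCoeff_reflect n q, h0] at hb
    simpa only [zero_div, map_zero, zero_mul, zero_add] using hb
  · rw [hT, ← hk]
    have h0 := coeff_ne_zero_of_eq_degree heq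
    have := prodJ_interleavedMatrix (k + 1) 0 fun i _ hi => hrel i (by omega)
    rw [zero_add] at this
    rw [this, hurwitzMatrix_eq_interleaved' hp hq' h0, h.one, h.zero]

theorem IsHurwitzFactorization.exists_chain {n r : ℕ} {p q : ℂ[X]} {c : ℕ → ℂ} {g : ℂ[X]}
    (hp : p.degree = n) (hq : q.degree ≤ n) (h : IsHurwitzFactorization n r p q c g) :
    (q.degree = n → c 0 = q.coeff n / p.coeff n) ∧ ∃ U,
      IsStieltjesChain (p.reflect n) (q.reflect n) c (fractionLength (ratioFun p q) r) U := by
  have hp' : p.natDegree ≤ n := natDegree_le_of_degree_le hp.le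
  have hq' : q.natDegree ≤ n := natDegree_le_of_degree_le hq
  have hpn : p.coeff n ≠ 0 := coeff_ne_zero_of_eq_degree hp
  set k := fractionLength (ratioFun p q) r with hk
  obtain ⟨V, h1, h2, h3⟩ := exists_continuants (k + 1) c (g.reflect g.natDegree)
  have h3' : ∀ i < k + 1, (V i : PowerSeries ℂ) = PowerSeries.C (c i) *
      (V (i + 1) : PowerSeries ℂ) + PowerSeries.X * (V (i + 2) : PowerSeries ℂ) := by
    intro i hi
    have := congrArg (fun f : ℂ[X] => (f : PowerSeries ℂ)) (h3 i hi)
    push_cast at this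
    exact this
  have hT : infMul (hurwitzMatrix 0 0 1) (toeplitzMatrix g) =
      interleavedMatrix (V (k + 1) : PowerSeries ℂ)
        (PowerSeries.X * (V (k + 2) : PowerSeries ℂ)) := by
    rw [infMul_hurwitzMatrix_zero_one, h1, h2, Polynomial.coe_zero, mul_zero]
  have key : (V 1 : PowerSeries ℂ) = (p.reflect n : PowerSeries ℂ) ∧
      ∃ κ, (q.degree = n → c 0 = κ) ∧ (q.reflect n : PowerSeries ℂ) =
        PowerSeries.C κ * (p.reflect n : PowerSeries ℂ) +
        PowerSeries.X * (V 2 : PowerSeries ℂ) := by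
    rcases hq.lt_or_eq with hlt | heq
    · have h0 := coeff_eq_zero_of_degree_lt hlt
      have h4 := h.2.1 hlt
      have h5 := prodJ_interleavedMatrix (c := c) (U := fun i => (V i : PowerSeries ℂ)) k 1
        fun i _ hi => h3' i (by omega)
      simp only [add_comm 1 k] at h5
      rw [hT, ← hk, h5, hurwitzMatrix_eq_interleaved hp' hq' h0] at h4
      obtain ⟨h6, h7⟩ := interleavedMatrix_inj h4
      refine ⟨h6.symm, 0, fun h8 => absurd h8 hlt.ne, ?_⟩
      rw [h7, map_zero, zero_mul, zero_add]
    · have h0 := coeff_ne_zero_of_eq_degree heq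
      have h4 := h.2.2 heq
      have h5 := prodJ_interleavedMatrix (c := c) (U := fun i => (V i : PowerSeries ℂ)) (k + 1) 0
        fun i _ hi => h3' i (by omega)
      simp only [zero_add] at h5
      rw [hT, ← hk, h5, hurwitzMatrix_eq_interleaved' hp' hq' h0] at h4
      obtain ⟨h6, h7⟩ := interleavedMatrix_inj h4
      have h8 := mul_left_cancel₀ PowerSeries.X_ne_zero h7
      refine ⟨h8.symm, c 0, fun _ => rfl, ?_⟩
      rw [h6, h8, h3' 0 (by omega)]
  obtain ⟨hV1, κ, hκ, hb⟩ := key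
  have hκ' : κ = q.coeff n / p.coeff n := by
    have := congrArg PowerSeries.constantCoeff hb
    simp only [map_add, map_mul, constantCoeff_reflect, PowerSeries.constantCoeff_C,
      PowerSeries.constantCoeff_X, zero_mul, add_zero] at this
    rw [this, mul_div_cancel_right₀ _ hpn]
  -- The factorization does not presuppose cᵢ ≠ 0. From V₁(0) = a₀ ≠ 0 and Vᵢ(0) = cᵢVᵢ₊₁(0) the
  -- nonvanishing propagates forward.
  have hne : ∀ i, i ≤ k → (V (i + 1)).coeff 0 ≠ 0 := by
    intro i
    induction i with
    | zero =>
      intro _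
      rw [zero_add, ← coe_constantCoeff, hV1, constantCoeff_reflect]
      exact hpn
    | succ i ih =>
      intro hi h0
      apply ih (by omega)
      rw [h3 (i + 1) (by omega)]
      simp [h0]
  refine ⟨fun heq => hκ' ▸ hκ heq, fun i => if i = 0 then (q.reflect n : PowerSeries ℂ) else V i,
    rfl, ?_, ?_, ?_, ?_, ?_⟩
  · simpa using hV1
  · rw [constantCoeff_reflect, constantCoeff_reflect, ← hκ']
    simpa using hb
  · intro i hi hik
    simp only [show i ≠ 0 by omega, Nat.succ_ne_zero, if_false]
    exact h3' i (by omega)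
  · simp [h2]
  · intro i hi hik
    obtain ⟨i, rfl⟩ : ∃ j, i = j + 1 := ⟨i - 1, by omega⟩
    simp only [Nat.succ_ne_zero, if_false, coe_constantCoeff]
    exact hne i (by omega)

/-! ### Chains and the regular Euclidean algorithm. -/

theorem X_mul_reflect_X_mul {n : ℕ} {W : ℂ[X]} (h : (X * W).natDegree ≤ n) :
    X * (X * W).reflect n = W.reflect n := by
  by_cases hW : W = 0
  · simp [hW]
  rw [natDegree_X_mul hW] at h
  obtain ⟨n, rfl⟩ : ∃ m, n = 1 + m := ⟨n - 1, by omega⟩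
  have h1 : W.natDegree ≤ n := by omega
  have h2 := reflect_mul (1 : ℂ[X]) W (F := 1) (by simp) h1
  rw [one_mul] at h2
  rw [reflect_mul X W natDegree_X_le h1, h2]
  simp

/-- `f` is the polynomial `z ^ (2 n - i) * U(1 / z²)`. -/
def IsParityReflection (n i : ℕ) (f U : ℂ[X]) : Prop :=
  U.natDegree ≤ n ∧ X ^ i * f = expand ℂ 2 (U.reflect n)

namespace IsParityReflection

variable {n i : ℕ} {f g U V W : ℂ[X]} {c : ℂ}

theorem eq_zero_iff (h : IsParityReflection n i f U) : f = 0 ↔ U = 0 := by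
  rw [← reflect_eq_zero_iff (N := n) (f := U), ← expand_eq_zero (p := 2) (f := U.reflect n) (by norm_num),
    ← h.2]
  simp

theorem sub_mul (hf : IsParityReflection n i f U) (hg : IsParityReflection n (i + 1) g V)
    (h : U = C c * V + X * W) : IsParityReflection n (i + 2) (f - C c * X * g) W := by
  have hXW : X * W = U - C c * V := by rw [h]; ring
  have hd : (X * W).natDegree ≤ n := by
    rw [hXW]
    exact (natDegree_sub_le _ _).trans (max_le hf.1 ((natDegree_C_mul_le _ _).trans hg.1))
  constructor
  · by_cases hW : W = 0
    · simp [hW]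
    · rw [natDegree_X_mul hW] at hd
      omega
  · rw [← X_mul_reflect_X_mul hd, hXW, map_mul, expand_X, reflect_sub, reflect_C_mul, map_sub,
      map_mul, expand_C, ← hf.2, ← hg.2]
    ring

theorem coeff_eq (h : IsParityReflection n i f U) (d : ℕ) (hd : i + d = 2 * n) :
    f.coeff d = U.coeff 0 := by
  have h1 := congrArg (fun F : ℂ[X] => F.coeff (2 * n)) h.2
  rw [← hd, add_comm i d, coeff_X_pow_mul, add_comm d i, hd, mul_comm,
    coeff_expand_mul (by norm_num), coeff_reflect_of_le _ le_rfl, Nat.sub_self] at h1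
  exact h1

theorem add_natDegree_le (h : IsParityReflection n i f U) (hf : f ≠ 0) :
    i + f.natDegree ≤ 2 * n := by
  have h1 := congrArg natDegree h.2
  rw [natDegree_X_pow_mul _ hf, natDegree_expand] at h1
  have := natDegree_reflect_le_of_le h.1
  omega

theorem ne_zero (h : IsParityReflection n i f U) (hU : U.coeff 0 ≠ 0) : f ≠ 0 := by
  rw [Ne, h.eq_zero_iff]
  rintro rfl
  simp at hU

theorem add_natDegree_eq (h : IsParityReflection n i f U) (hU : U.coeff 0 ≠ 0) :
    i + f.natDegree = 2 * n := by
  have h1 := congrArg natDegree h.2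
  rw [natDegree_X_pow_mul _ (h.ne_zero hU), natDegree_expand] at h1
  have h2 := natDegree_reflect_le_of_le h.1
  have h3 : n ≤ (U.reflect n).natDegree := by
    apply le_natDegree_of_ne_zero
    rwa [coeff_reflect_of_le _ le_rfl, Nat.sub_self]
  omega

theorem coeff_zero_ne_zero (h : IsParityReflection n i f U) (hf : f ≠ 0)
    (hd : i + f.natDegree = 2 * n) : U.coeff 0 ≠ 0 := by
  rw [← h.coeff_eq _ hd]
  exact leadingCoeff_ne_zero.2 hf

end IsParityReflection

theorem div_mod_eq_of_degree_lt {f g u h : ℂ[X]} (he : f = g * u + h)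
    (hd : h.degree < g.degree) : f / g = u ∧ f % g = h := by
  have hg : g ≠ 0 := by
    rintro rfl
    simp at hd
  have h1 : g * (f / g) + f % g = f := EuclideanDomain.div_add_mod f g
  have h2 : (f % g).degree < g.degree := EuclideanDomain.mod_lt f hg
  have h3 : g * (f / g - u) = h - f % g := by linear_combination h1 + he
  have h4 : f / g - u = 0 := by
    by_contra h5
    have h6 : (g * (f / g - u)).degree < g.degree := by
      rw [h3]
      exact (degree_sub_le _ _).trans_lt (max_lt hd h2)
    rw [degree_mul] at h6
    have h7 : (0 : WithBot ℕ) ≤ (f / g - u).degree := zero_le_degree_iff.2 h5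
    exact absurd h6 (not_lt.2 (le_add_of_nonneg_right h7))
  rw [h4, mul_zero, eq_comm, sub_eq_zero] at h3
  exact ⟨sub_eq_zero.1 h4, h3.symm⟩

/-- Since V(0) ≠ 0, g has the full degree 2n - i - 1. The difference f - czg has degree at most 2n -
i - 2, so it is the remainder. -/
theorem IsParityReflection.div_mod {n i : ℕ} {f g U V W : ℂ[X]} {c : ℂ}
    (hf : IsParityReflection n i f U) (hg : IsParityReflection n (i + 1) g V)
    (h : U = C c * V + X * W) (hV : V.coeff 0 ≠ 0) :
    f / g = C c * X ∧ f % g = f - C c * X * g := by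
  apply div_mod_eq_of_degree_lt
  · ring
  · by_cases h0 : f - C c * X * g = 0
    · rw [h0, degree_zero, bot_lt_iff_ne_bot, Ne, degree_eq_bot]
      exact hg.ne_zero hV
    · apply degree_lt_degree
      have h1 := (hf.sub_mul hg h).add_natDegree_le h0
      have h2 := hg.add_natDegree_eq hV
      omega

theorem regularEuclid_of_chain {n k : ℕ} {c : ℕ → ℂ} {T : ℕ → ℂ[X]}
    (hrel : ∀ i < k, T i = C (c i) * T (i + 1) + X * T (i + 2))
    (hlast : T (k + 1) = 0) (hne : ∀ i ≤ k, (T i).coeff 0 ≠ 0) (d : ℕ) :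
    ∀ (i : ℕ) (f g : ℂ[X]), i + d = k → IsParityReflection n i f (T i) →
      IsParityReflection n (i + 1) g (T (i + 1)) → RegularEuclid f g := by
  induction d with
  | zero =>
    rintro i f g rfl hf hg
    rw [hg.eq_zero_iff.2 hlast]
    exact RegularEuclid.done f
  | succ d ih =>
    intro i f g hi hf hg
    have hV := hne (i + 1) (by omega)
    obtain ⟨h1, h2⟩ := hf.div_mod hg (hrel i (by omega)) hV
    have hc : c i ≠ 0 := by
      intro h0
      apply hne i (by omega)
      rw [hrel i (by omega), h0]
      simp
    refine RegularEuclid.step f g (hg.ne_zero hV) ?_ ?_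
    · rw [h1, degree_C_mul_X hc]
    · rw [h2]
      exact ih (i + 1) g _ (by omega) hg (hf.sub_mul hg (hrel i (by omega)))

theorem RegularEuclid.exists_chain {n : ℕ} {f g : ℂ[X]} (h : RegularEuclid f g) :
    ∀ (i : ℕ) (U V : ℂ[X]), IsParityReflection n i f U → IsParityReflection n (i + 1) g V →
      U.coeff 0 ≠ 0 → ∃ (m : ℕ) (c : ℕ → ℂ) (T : ℕ → ℂ[X]), T 0 = U ∧ T 1 = V ∧
        (∀ j < m, T j = C (c j) * T (j + 1) + X * T (j + 2)) ∧ T (m + 1) = 0 ∧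
        ∀ j ≤ m, (T j).coeff 0 ≠ 0 := by
  induction h with
  | done f =>
    intro i U V hf hg hU
    refine ⟨0, 0, fun j => if j = 0 then U else V, rfl, rfl, by simp, ?_, ?_⟩
    · simpa using hg.eq_zero_iff.1 rfl
    · intro j hj
      simpa [Nat.le_zero.1 hj] using hU
  | step f g hg0 hd _ ih =>
    intro i U V hf hg hU
    have hfd := hf.add_natDegree_eq hU
    have hle : g.degree ≤ f.degree := by
      by_contra! hlt
      rw [(Polynomial.div_eq_zero_iff hg0).2 hlt] at hd
      simp at hd
    have h1 := degree_add_div hg0 hle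
    rw [hd, degree_eq_natDegree hg0, degree_eq_natDegree (hf.ne_zero hU)] at h1
    have h2 : g.natDegree + 1 = f.natDegree := by exact_mod_cast h1
    -- A quotient of degree one forces deg g = deg f - 1 = 2n - i - 1, the maximal degree, and this
    -- is equivalent to V(0) ≠ 0.
    have hV := hg.coeff_zero_ne_zero hg0 (by omega)
    have hrel : U = C (U.coeff 0 / V.coeff 0) * V +
        X * divX (U - C (U.coeff 0 / V.coeff 0) * V) := remSeq_rel (U := U) (V := V) (i := 0) hV
    obtain ⟨_, h3⟩ := hf.div_mod hg hrel hV
    rw [h3] at ih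
    obtain ⟨m, c, T, e0, e1, e2, e3, e4⟩ := ih (i + 1) _ _ hg (hf.sub_mul hg hrel) hV
    refine ⟨m + 1, fun j => Nat.casesOn j (U.coeff 0 / V.coeff 0) c,
      fun j => Nat.casesOn j U T, rfl, e0, ?_, e3, ?_⟩
    · rintro (_ | j) hj
      · change U = C _ * T 0 + X * T 1
        rw [e0, e1]
        exact hrel
      · exact e2 j (by omega)
    · rintro (_ | j) hj
      · exact hU
      · exact e4 j (by omega)

theorem natDegree_X_mul_sub_le {n : ℕ} {p q : ℂ[X]} (hp : p.degree = n) (hq : q.degree ≤ n) :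
    (X * (q - C (q.coeff n / p.coeff n) * p)).natDegree ≤ n := by
  set s := q - C (q.coeff n / p.coeff n) * p with hs
  by_cases h0 : s = 0
  · simp [h0]
  have h1 : s.degree ≤ n := by
    refine (degree_sub_le _ _).trans (max_le hq ?_)
    rw [C_mul']
    exact (degree_smul_le _ _).trans hp.le
  have h2 : s.coeff n = 0 := by
    rw [hs, coeff_sub, coeff_C_mul, div_mul_cancel₀ _ (coeff_ne_zero_of_eq_degree hp), sub_self]
  rw [coeff_eq_zero_iff_degree_lt h1, ← natDegree_lt_iff_degree_lt h0] at h2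
  rw [natDegree_X_mul h0]
  exact h2

theorem reflect_eq_add_X_mul {n : ℕ} {p q : ℂ[X]} (hp : p.degree = n) (hq : q.degree ≤ n) :
    q.reflect n = C (q.coeff n / p.coeff n) * p.reflect n +
      X * (X * (q - C (q.coeff n / p.coeff n) * p)).reflect n := by
  rw [X_mul_reflect_X_mul (natDegree_X_mul_sub_le hp hq), reflect_sub, reflect_C_mul]
  ring

theorem isParityReflection_comp {n : ℕ} {p : ℂ[X]} (hp : p.natDegree ≤ n) :
    IsParityReflection n 0 (p.comp (X ^ 2)) (p.reflect n) :=
  ⟨natDegree_reflect_le_of_le hp, by rw [reflect_reflect, pow_zero, one_mul]; rfl⟩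

theorem isParityReflection_X_mul_sub {n : ℕ} {p q : ℂ[X]} (hp : p.degree = n)
    (hq : q.degree ≤ n) :
    IsParityReflection n 1 (X * q.comp (X ^ 2) -
        C (descCoeff n q 0 / descCoeff n p 0) * X * p.comp (X ^ 2))
      ((X * (q - C (q.coeff n / p.coeff n) * p)).reflect n) := by
  refine ⟨natDegree_reflect_le_of_le (natDegree_X_mul_sub_le hp hq), ?_⟩
  rw [reflect_reflect, descCoeff_zero, descCoeff_zero, ← expand_eq_comp_X_pow,
    ← expand_eq_comp_X_pow, map_mul, expand_X, map_sub, map_mul, expand_C]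
  ring

theorem exists_stieltjesChain_of_regularEuclid {n : ℕ} {p q : ℂ[X]} (hp : p.degree = n)
    (hq : q.degree ≤ n)
    (h : RegularEuclid (p.comp (X ^ 2)) (X * q.comp (X ^ 2) -
      C (descCoeff n q 0 / descCoeff n p 0) * X * p.comp (X ^ 2))) :
    ∃ k c U, IsStieltjesChain (p.reflect n) (q.reflect n) c k U := by
  have hpn : p.coeff n ≠ 0 := coeff_ne_zero_of_eq_degree hp
  obtain ⟨m, c, T, e0, e1, e2, e3, e4⟩ := h.exists_chain 0 _ _
    (isParityReflection_comp (natDegree_le_of_degree_le hp.le))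
    (isParityReflection_X_mul_sub hp hq)
    (by rwa [← coe_constantCoeff, constantCoeff_reflect])
  refine ⟨m, fun i => c (i - 1), fun i => Nat.casesOn i (q.reflect n : PowerSeries ℂ)
    (fun j => (T j : PowerSeries ℂ)), rfl, ?_, ?_, ?_, ?_, ?_⟩
  · simp [e0]
  · rw [constantCoeff_reflect, constantCoeff_reflect]
    change _ = _ + PowerSeries.X * (T 1 : PowerSeries ℂ)
    rw [e1]
    have := congrArg (fun f : ℂ[X] => (f : PowerSeries ℂ)) (reflect_eq_add_X_mul hp hq)
    push_cast at this
    exact this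
  · rintro (_ | i) h1 hi
    · omega
    · have := congrArg (fun f : ℂ[X] => (f : PowerSeries ℂ)) (e2 i (by omega))
      push_cast at this
      exact this
  · simp [e3]
  · rintro (_ | i) h1 hi
    · omega
    · change PowerSeries.constantCoeff (T i : PowerSeries ℂ) ≠ 0
      rw [coe_constantCoeff]
      exact e4 i (by omega)

theorem regularEuclid_of_stieltjesChain {n k : ℕ} {p q : ℂ[X]} (hp : p.degree = n)
    (hq : q.degree ≤ n) {c : ℕ → ℂ} {U : ℕ → ℂ[X]}
    (h : IsStieltjesChain (p.reflect n) (q.reflect n) c k (fun i => (U i : PowerSeries ℂ))) :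
    RegularEuclid (p.comp (X ^ 2)) (X * q.comp (X ^ 2) -
      C (descCoeff n q 0 / descCoeff n p 0) * X * p.comp (X ^ 2)) := by
  have h1 : U 1 = p.reflect n := Polynomial.coe_injective ℂ h.one
  have h2 : U 2 = (X * (q - C (q.coeff n / p.coeff n) * p)).reflect n := by
    have h3 := h.rel_zero
    rw [constantCoeff_reflect, constantCoeff_reflect] at h3
    have h4 := reflect_eq_add_X_mul hp hq
    apply Polynomial.coe_injective ℂ
    apply mul_left_cancel₀ (PowerSeries.X_ne_zero (R := ℂ))
    have h5 := congrArg (fun f : ℂ[X] => (f : PowerSeries ℂ)) h4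
    push_cast at h5
    linear_combination h5 - h3
  refine regularEuclid_of_chain (n := n) (k := k) (c := fun i => c (i + 1))
    (T := fun i => U (i + 1)) ?_ ?_ ?_ k 0 _ _ (by omega) ?_ ?_
  · intro i hi
    apply Polynomial.coe_injective ℂ
    push_cast
    exact h.rel (i + 1) (by omega) (by omega)
  · apply Polynomial.coe_injective ℂ
    rw [Polynomial.coe_zero]
    exact h.last
  · intro i hi
    rw [← coe_constantCoeff]
    exact h.ne_zero (i + 1) (by omega) (by omega)
  · rw [zero_add, h1]
    exact isParityReflection_comp (natDegree_le_of_degree_le hp.le)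
  · change IsParityReflection n 1 _ (U 2)
    rw [h2]
    exact isParityReflection_X_mul_sub hp hq

/-! ### Assembling the equivalences. -/

/-- If b₀ = 0, then b = wU₂, so b₁ = U₂(0). This is nonzero once k ≥ 1, and k = 0 would give q = 0.
-/
theorem IsStieltjesChain.sub_one_le_natDegree {n k : ℕ} {p q : ℂ[X]} {c : ℕ → ℂ}
    {U : ℕ → PowerSeries ℂ} (hq : q ≠ 0)
    (h : IsStieltjesChain (p.reflect n) (q.reflect n) c k U) :
    (n : ℤ) - 1 ≤ q.natDegree := by
  by_cases h0 : q.coeff n = 0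
  · have h1 := h.rel_zero
    rw [constantCoeff_reflect, h0, zero_div, map_zero, zero_mul, zero_add] at h1
    rcases Nat.eq_zero_or_pos n with rfl | hn
    · simp
    have hk : 1 ≤ k := by
      by_contra hk
      obtain rfl : k = 0 := by omega
      have h2 := h.last
      rw [zero_add] at h2
      rw [h2, mul_zero] at h1
      apply hq
      rw [← reflect_eq_zero_iff (N := n)]
      exact Polynomial.coe_injective ℂ (by rw [h1, Polynomial.coe_zero])
    have h3 := congrArg (PowerSeries.coeff 1) h1
    rw [Polynomial.coeff_coe, coeff_reflect_of_le _ hn] at h3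
    have h4 := h.ne_zero 2 (by omega) (by omega)
    have h5 : PowerSeries.coeff (0 + 1) (PowerSeries.X * U 2) = PowerSeries.coeff 0 (U 2) :=
      PowerSeries.coeff_succ_X_mul _ _
    rw [zero_add] at h5
    rw [h5, PowerSeries.coeff_zero_eq_constantCoeff_apply] at h3
    have h6 := le_natDegree_of_ne_zero (h3 ▸ h4 : q.coeff (n - 1) ≠ 0)
    omega
  · have := le_natDegree_of_ne_zero h0
    omega

theorem hankelMinor_laurentCoeff_eq_zero_iff {n r : ℕ} {p q : ℂ[X]} (hp : p.degree = n)
    (hq : q.degree ≤ n) (hr : poleCount (ratioFun p q) = r) {j : ℕ} (hj : r ≤ j) :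
    hankelMinor (laurentCoeff n p q) j = 0 ↔ r < j := by
  obtain ⟨g, p', q', -, -, -, hp0, hc, hpr, hqr, -, hs, -, -⟩ := exists_reduced hp hq hr
  rw [hs, hankelMinor_eq_zero_iff hpr hp0 hqr hc hj]

theorem shiftedHankelMinor_laurentCoeff_eq_zero_iff {n r : ℕ} {p q : ℂ[X]} (hp : p.degree = n)
    (hq : q.degree ≤ n) (hr : poleCount (ratioFun p q) = r) {j : ℕ} (hj : r ≤ j) :
    shiftedHankelMinor (laurentCoeff n p q) j = 0 ↔ r < j ∨ HasPoleAt (ratioFun p q) 0 := by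
  obtain ⟨g, p', q', -, -, -, hp0, hc, hpr, hqr, -, hs, -, hz⟩ := exists_reduced hp hq hr
  rw [hs, shiftedHankelMinor_eq_zero_iff hpr hp0 hqr hc hj, hz]

/-- A chain of length k kills all normalized minors of order at least k + 2, whereas the minor of
order 2r is Dᵣ ≠ 0. -/
theorem IsStieltjesChain.two_mul_le {n r k : ℕ} {p q : ℂ[X]} {c : ℕ → ℂ}
    {U : ℕ → PowerSeries ℂ} (hp : p.degree = n) (hq : q.degree ≤ n)
    (hr : poleCount (ratioFun p q) = r)
    (h : IsStieltjesChain (p.reflect n) (q.reflect n) c k U) : 2 * r ≤ k + 1 := by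
  by_contra! hk
  have h1 := h.normalized_eq_zero (N := 2 * r) hk
  rw [← h.hankelMinor_eq, ← laurentCoeff_eq (natDegree_le_of_degree_le hp.le)
    (natDegree_le_of_degree_le hq), hankelMinor_laurentCoeff_eq_zero_iff hp hq hr le_rfl] at h1
  exact h1.false

theorem IsStieltjesChain.hankelCondition {n r k : ℕ} {p q : ℂ[X]} {c : ℕ → ℂ}
    {U : ℕ → PowerSeries ℂ} (hp : p.degree = n) (hq : q.degree ≤ n)
    (hr : poleCount (ratioFun p q) = r)
    (h : IsStieltjesChain (p.reflect n) (q.reflect n) c k U) :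
    HankelCondition (laurentCoeff n p q) r := by
  have hk := h.two_mul_le hp hq hr
  have hs := laurentCoeff_eq (natDegree_le_of_degree_le hp.le) (natDegree_le_of_degree_le hq)
  refine ⟨fun j hj => ?_, fun j hj => ?_, fun j hj => ⟨?_, ?_⟩⟩
  · rw [Finset.mem_Icc] at hj
    rw [hs, h.hankelMinor_eq]
    exact h.normalized_minor_ne_zero (by omega)
  · rw [Finset.mem_Icc] at hj
    rw [hs, h.shiftedHankelMinor_eq]
    exact mul_ne_zero (pow_ne_zero _ (by norm_num)) (h.normalized_minor_ne_zero (by omega))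
  · rw [hankelMinor_laurentCoeff_eq_zero_iff hp hq hr (by omega)]
    exact hj
  · rw [shiftedHankelMinor_laurentCoeff_eq_zero_iff hp hq hr (by omega)]
    exact Or.inl hj

theorem HankelCondition.exists_chain {n r : ℕ} {p q : ℂ[X]} (hp : p.degree = n)
    (hq : q.degree ≤ n) (hr : poleCount (ratioFun p q) = r)
    (h : HankelCondition (laurentCoeff n p q) r) :
    ∃ (c : ℕ → ℂ) (U : ℕ → ℂ[X]) (g : ℂ[X]), c 0 = q.coeff n / p.coeff n ∧
      IsStieltjesChain (p.reflect n) (q.reflect n) c (fractionLength (ratioFun p q) r)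
        (fun i => (U i : PowerSeries ℂ)) ∧
      IsGreatestCommonDivisor g p q ∧
      U (fractionLength (ratioFun p q) r + 1) = g.reflect g.natDegree := by
  obtain ⟨g, p', q', hpg, hqg, hg0, hp0, hc, hpr, hqr, hn, hs, -, hz⟩ := exists_reduced hp hq hr
  set k := fractionLength (ratioFun p q) r with hk
  have hk' : (p'.IsRoot 0 ∧ k = 2 * r - 1) ∨ (¬ p'.IsRoot 0 ∧ k = 2 * r) := by
    rw [hk, fractionLength, ← hz]
    by_cases h0 : HasPoleAt (ratioFun p q) 0
    · exact Or.inl ⟨h0, if_pos h0⟩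
    · exact Or.inr ⟨h0, if_neg h0⟩
  have hk2 : 2 * r ≤ k + 1 := by omega
  rw [hs] at h
  obtain ⟨c, U, hc0, hU, hsupp⟩ := exists_stieltjesChain hpr hp0 hqr hc h.1 h.2.1 hk'
  -- For the coprime pair the last nonzero series is a constant by the degree bound. This κ is the
  -- required normalization of the gcd.
  have hκ : U (k + 1) = C ((U (k + 1)).coeff 0) := by
    ext m
    rw [coeff_C]
    split_ifs with hm
    · rw [hm]
    · exact hsupp _ _ (by omega)
  set κ := (U (k + 1)).coeff 0 with hκdef
  have hκ0 : κ ≠ 0 := by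
    rw [hκdef, ← coe_constantCoeff]
    exact hU.ne_zero (k + 1) (by omega) le_rfl
  have hpn : p.reflect n = g.reflect g.natDegree * p'.reflect r := by
    rw [← reflect_mul _ _ le_rfl hpr.le, hn, hpg]
  have hqn : q.reflect n = g.reflect g.natDegree * q'.reflect r := by
    rw [← reflect_mul _ _ le_rfl hqr, hn, hqg]
  have hG : PowerSeries.constantCoeff (g.reflect g.natDegree : PowerSeries ℂ) ≠ 0 := by
    rw [constantCoeff_reflect]
    exact leadingCoeff_ne_zero.2 hg0
  refine ⟨c, fun i => g.reflect g.natDegree * U i, C κ * g, ?_, ?_, ?_, ?_⟩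
  · rw [hc0, ← constantCoeff_reflect n q, ← constantCoeff_reflect n p, hqn, hpn,
      Polynomial.coe_mul, Polynomial.coe_mul, map_mul, map_mul, mul_div_mul_left _ _ hG,
      constantCoeff_reflect, constantCoeff_reflect]
  · have := hU.mul_left hG
    simp only [← Polynomial.coe_mul, ← hpn, ← hqn] at this
    exact this
  · have hu : IsUnit (C κ) := isUnit_C.2 hκ0.isUnit
    refine ⟨?_, ?_, ?_⟩
    · rw [hu.mul_left_dvd]
      exact ⟨p', hpg⟩
    · rw [hu.mul_left_dvd]
      exact ⟨q', hqg⟩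
    · intro d hdp hdq
      obtain ⟨u, v, huv⟩ := hc
      have : C κ * g = C κ * u * p + C κ * v * q := by
        rw [hpg, hqg]
        linear_combination (-C κ * g) * huv
      rw [this]
      exact dvd_add (hdp.mul_left _) (hdq.mul_left _)
  · simp only
    rw [natDegree_C_mul hκ0, reflect_C_mul, hκ, mul_comm]

theorem le_fractionLength (R : RatFunc ℂ) (r : ℕ) : 2 * r ≤ fractionLength R r + 1 := by
  unfold fractionLength
  split_ifs <;> omega

theorem IsStieltjesExpansion.exists_chain {n r : ℕ} {p q : ℂ[X]} {c : ℕ → ℂ}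
    (hp : p.degree = n) (hq : q.degree ≤ n) (h : IsStieltjesExpansion n r p q c) :
    c 0 = q.coeff n / p.coeff n ∧ ∃ U,
      IsStieltjesChain (p.reflect n) (q.reflect n) c (fractionLength (ratioFun p q) r) U := by
  obtain ⟨h0, h1, h2⟩ := h
  rw [descCoeff_zero, descCoeff_zero] at h0
  exact ⟨h0, exists_stieltjesChain_of_ratioFun_sub_eq (natDegree_le_of_degree_le hp.le)
    (coeff_ne_zero_of_eq_degree hp) (natDegree_le_of_degree_le hq) h0
    (fun j h3 h4 => h1 j (Finset.mem_Icc.2 ⟨h3, h4⟩)) h2⟩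

theorem mainTheorem6 (n r : ℕ) (p q : ℂ[X])
    (hp : p.degree = n) (hq : q.degree ≤ n) (hq0 : q ≠ 0)
    (hr : poleCount (ratioFun p q) = r) :
    List.TFAE [
      HankelCondition (laurentCoeff n p q) r,
      ∃ c : ℕ → ℂ, IsStieltjesExpansion n r p q c,
      RegularEuclid (p.comp (X ^ 2))
          (X * q.comp (X ^ 2)
            - C (descCoeff n q 0 / descCoeff n p 0) * X * p.comp (X ^ 2)) ∧
        (n : ℤ) - 1 ≤ q.natDegree,
      ∃ (c : ℕ → ℂ) (g : ℂ[X]), IsHurwitzFactorization n r p q c g] ∧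
    (shiftedHankelMinor (laurentCoeff n p q) r = 0 ↔ HasPoleAt (ratioFun p q) 0) ∧
    (∀ c : ℕ → ℂ,
      (IsStieltjesExpansion n r p q c ∨ ∃ g : ℂ[X], IsHurwitzFactorization n r p q c g) →
        (∀ j ∈ Finset.Icc 1 (fractionLength (ratioFun p q) r), c j ≠ 0) ∧
        HankelFormulas (laurentCoeff n p q) r (fractionLength (ratioFun p q) r) c ∧
        HurwitzFormulas n p q r (fractionLength (ratioFun p q) r) c) := by
  have hp' : p.natDegree ≤ n := natDegree_le_of_degree_le hp.le
  have hq' : q.natDegree ≤ n := natDegree_le_of_degree_le hq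
  refine ⟨?_, ?_, ?_⟩
  · tfae_have 1 → 2
    | h => by
      obtain ⟨c, U, g, hc, hU, -, -⟩ := h.exists_chain hp hq hr
      refine ⟨c, ?_, fun j hj => ?_, ratioFun_sub_eq_stieltjesFraction hp' hq' hc hU⟩
      · rw [hc, descCoeff_zero, descCoeff_zero]
      · rw [Finset.mem_Icc] at hj
        exact hU.coeff_ne_zero hj.1 hj.2
    tfae_have 2 → 1
    | ⟨c, h⟩ => by
      obtain ⟨-, U, hU⟩ := h.exists_chain hp hq
      exact hU.hankelCondition hp hq hr
    tfae_have 1 → 3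
    | h => by
      obtain ⟨c, U, g, hc, hU, -, -⟩ := h.exists_chain hp hq hr
      exact ⟨regularEuclid_of_stieltjesChain hp hq hU, hU.sub_one_le_natDegree hq0⟩
    tfae_have 3 → 1
    | ⟨h, _⟩ => by
      -- The length of this chain need not be identified: 2r ≤ k + 1 is enough for the Hankel
      -- condition.
      obtain ⟨k, c, U, hU⟩ := exists_stieltjesChain_of_regularEuclid hp hq h
      exact hU.hankelCondition hp hq hr
    tfae_have 1 → 4
    | h => by
      obtain ⟨c, U, g, hc, hU, hg, hgU⟩ := h.exists_chain hp hq hr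
      exact ⟨c, g, hU.isHurwitzFactorization hp' hq hc hg (by rw [hgU])⟩
    tfae_have 4 → 1
    | ⟨c, g, h⟩ => by
      obtain ⟨-, U, hU⟩ := h.exists_chain hp hq
      exact hU.hankelCondition hp hq hr
    tfae_finish
  · simpa using shiftedHankelMinor_laurentCoeff_eq_zero_iff hp hq hr (le_refl r)
  · intro c h
    have hchain : (q.degree = n → c 0 = q.coeff n / p.coeff n) ∧ ∃ U, IsStieltjesChain
        (p.reflect n) (q.reflect n) c (fractionLength (ratioFun p q) r) U := by
      rcases h with h | ⟨g, h⟩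
      · obtain ⟨h0, hU⟩ := h.exists_chain hp hq
        exact ⟨fun _ => h0, hU⟩
      · exact h.exists_chain hp hq
    obtain ⟨hc, U, hU⟩ := hchain
    have hk := le_fractionLength (ratioFun p q) r
    refine ⟨fun j hj => ?_, ?_, hU.hurwitzFormulas hp' hq hk hc⟩
    · rw [Finset.mem_Icc] at hj
      exact hU.coeff_ne_zero hj.1 hj.2
    · rw [laurentCoeff_eq hp' hq']
      exact hU.hankelFormulas hk
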